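/- **Notation.** Write $(a)_n=a(a+1)\cdots(a+n-1)$ for the Pochhammer symbol, and for complex parameters with $\mathrm{Re}\,p,\mathrm{Re}\,q,\mathrm{Re}\,\upsilon>0$ let $$E_{p,q,\upsilon}^{(\gamma_1;\dots;\gamma_6)}(z,t)=\sum_{l=0}^\infty\sum_{m=0}^\infty \frac{(-1)^l(\gamma_1)_{2l}(\gamma_2)_{l+m}(\gamma_3)_l\,z^l\,t^{\upsilon m}}{(\gamma_4)_l(\gamma_5)_l(\gamma_6)_l\,\Gamma(p+l)\,\Gamma(q+\upsilon m)\,m!\,l!},$$ where, whenever $(\gamma_4)_l(\gamma_5)_l(\gamma_6)_l=0$, the quotient of Pochhammer symbols is read by continuity, as the limit for $\varepsilon\to0$, $\varepsilon\ne0$, of the quotient with parameters $(\gamma_1+2\varepsilon;\gamma_2+\varepsilon;\dots;\gamma_6+\varepsilon)$. (These shifts preserve the relations $\gamma_4=\frac{\gamma_1+1}2$, $\gamma_5=\gamma_2$, $\gamma_6=\gamma_3$ used below, and under these relations the limit exists.) Powers are principal values. Fix $w_1,w_2\in\mathbb C$ and real $a_1<b_1$, $a_2<b_2$, and put $R=(a_1,b_1)\times(a_2,b_2)$.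 For $(z,t)\in R$ let $$\big(\mathfrak E_{p,q,\upsilon}^{(\gamma_1;\dots;\gamma_6)}d\big)(z,t)=\int_{a_2}^t\!\int_{a_1}^z (z-\xi)^{p-1}(t-y)^{q-1}E_{p,q,\upsilon}^{(\gamma_1;\dots;\gamma_6)}\big(w_1(z-\xi),w_2(t-y)\big)\,d(\xi,y)\,d\xi\,dy .$$ For $\mathrm{Re}\,\alpha,\mathrm{Re}\,\beta>0$ let $${}_t\mathbb I^{\beta}_{a_2^+}\,{}_z\mathbb I^{\alpha}_{a_1^+}f(z,t)=\frac1{\Gamma(\alpha)\Gamma(\beta)}\int_{a_2}^t\!\int_{a_1}^z(z-\xi)^{\alpha-1}(t-y)^{\beta-1}f(\xi,y)\,d\xi\,dy$$ and $${}_tD^{\beta}_{a_2^+}\,{}_zD^{\alpha}_{a_1^+}f=\frac{\partial^r}{\partial t^r}\frac{\partial^n}{\partial z^n}\,{}_t\mathbb I^{r-\beta}_{a_2^+}\,{}_z\mathbb I^{n-\alpha}_{a_1^+}f,\qquad n=\lfloor\mathrm{Re}\,\alpha\rfloor+1,\quad r=\lfloor\mathrm{Re}\,\beta\rfloor+1 .$$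 **Theorem.** Let $p,q,\sigma,\tau,\upsilon,\gamma_1,\gamma_2,\gamma_3\in\mathbb C$ all have positive real part and let $w_1,w_2\in\mathbb C$. Then the double series defining $E_{p,q,\upsilon}^{(\gamma_1;\gamma_2;\gamma_3;\frac{\gamma_1+1}2;\gamma_2;\gamma_3)}$ and $E_{\sigma,\tau,\upsilon}^{(-\gamma_1;-\gamma_2;-\gamma_3;\frac{-\gamma_1+1}2;-\gamma_2;-\gamma_3)}$ converge absolutely at all $(z,t)\in\mathbb C^2$, and the operator $\mathfrak E_{p,q,\upsilon}^{(\gamma_1;\gamma_2;\gamma_3;\frac{\gamma_1+1}2;\gamma_2;\gamma_3)}$ has on $L^1(R)$ (complex-valued functions) the left inverse $$\mathbb D\,\varphi={}_tD^{q+\tau}_{a_2^+}\,{}_zD^{p+\sigma}_{a_1^+}\Big(\mathfrak E_{\sigma,\tau,\upsilon}^{(-\gamma_1;-\gamma_2;-\gamma_3;\frac{-\gamma_1+1}2;-\gamma_2;-\gamma_3)}\varphi\Big).$$ That is, for every $d\in L^1(R)$ the integral defining $\mathfrak E_{p,q,\upsilon}^{(\gamma_1;\gamma_2;\gamma_3;\frac{\gamma_1+1}2;\gamma_2;\gamma_3)}d$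 converges absolutely almost everywhere on $R$ and defines an element of $L^1(R)$. If $\varphi$ is any function equal to it almost everywhere on $R$, then the integral defining $\mathfrak E_{\sigma,\tau,\upsilon}^{(-\gamma_1;-\gamma_2;-\gamma_3;\frac{-\gamma_1+1}2;-\gamma_2;-\gamma_3)}\varphi$ also converges absolutely almost everywhere on $R$ and defines an element of $L^1(R)$. Moreover, at almost every $(z,t)\in R$ the integrals and (iterated) derivatives in $\mathbb D\varphi(z,t)$ exist, and $\mathbb D\varphi(z,t)=d(z,t)$. -/

import Mathlib

open MeasureTheory Filter Topology

noncomputable section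

namespace IKonhauser

/-- The Pochhammer symbol `(a)_n = a (a + 1) ⋯ (a + n - 1)`. -/
def poch (a : ℂ) (n : ℕ) : ℂ := (ascPochhammer ℂ n).eval a

/-- The quotient `(γ₁)_{2l} (γ₂)_{l+m} (γ₃)_l / ((γ₄)_l (γ₅)_l (γ₆)_l)`, where the six parameters
`γ₁, …, γ₆` are `g 0, …, g 5`. -/
def pochQuot (g : Fin 6 → ℂ) (l m : ℕ) : ℂ :=
  (poch (g 0) (2 * l) * poch (g 1) (l + m) * poch (g 2) l)
    / (poch (g 3) l * poch (g 4) l * poch (g 5) l)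

open Classical in
/-- The quotient `pochQuot g l m` where its denominator is nonzero. Where the denominator vanishes,
the quotient is read by continuity, as its limit along `(γ₁ + 2ε; γ₂ + ε; …; γ₆ + ε)`, `ε → 0`.
These shifts preserve the relations `γ₄ = (γ₁ + 1) / 2`, `γ₅ = γ₂`, `γ₆ = γ₃`. -/
def mlCoeff (g : Fin 6 → ℂ) (l m : ℕ) : ℂ :=
  if poch (g 3) l * poch (g 4) l * poch (g 5) l ≠ 0 then pochQuot g l m
  else limUnder (𝓝[≠] (0 : ℂ))
    (fun ε => pochQuot (fun i => g i + (![2, 1, 1, 1, 1, 1] : Fin 6 → ℂ) i * ε) l m)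

/-- The `(l, m)` term of the modified bivariate I-Konhauser Mittag-Leffler series. -/
def mlTerm (g : Fin 6 → ℂ) (p q υ z t : ℂ) (l m : ℕ) : ℂ :=
  (-1) ^ l * mlCoeff g l m * z ^ l * t ^ (υ * (m : ℂ))
    / (Complex.Gamma (p + l) * Complex.Gamma (q + υ * m) * (m.factorial : ℂ) * (l.factorial : ℂ))

/-- The modified bivariate I-Konhauser Mittag-Leffler function (a double series). -/
def mlFun (g : Fin 6 → ℂ) (p q υ z t : ℂ) : ℂ :=
  ∑' i : ℕ × ℕ, mlTerm g p q υ z t i.1 i.2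

/-- The parameters `(γ₁; γ₂; γ₃; (γ₁ + 1) / 2; γ₂; γ₃)`. -/
def tiedParams (γ₁ γ₂ γ₃ : ℂ) : Fin 6 → ℂ := ![γ₁, γ₂, γ₃, (γ₁ + 1) / 2, γ₂, γ₃]

/-- The integrand, at the source point `s = (ξ, y)`, of the operator `𝔈` evaluated at `(z, t)`. -/
def mlIntegrand (g : Fin 6 → ℂ) (p q υ w₁ w₂ : ℂ) (d : ℝ × ℝ → ℂ) (z t : ℝ) (s : ℝ × ℝ) : ℂ :=
  ((z - s.1 : ℝ) : ℂ) ^ (p - 1) * ((t - s.2 : ℝ) : ℂ) ^ (q - 1)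
    * mlFun g p q υ (w₁ * ((z - s.1 : ℝ) : ℂ)) (w₂ * ((t - s.2 : ℝ) : ℂ)) * d s

/-- The double integral operator `𝔈` with base point `(a₁, a₂)`. -/
def mlOp (g : Fin 6 → ℂ) (p q υ w₁ w₂ : ℂ) (a₁ a₂ : ℝ) (d : ℝ × ℝ → ℂ) (x : ℝ × ℝ) : ℂ :=
  ∫ s in Set.Ioo a₁ x.1 ×ˢ Set.Ioo a₂ x.2, mlIntegrand g p q υ w₁ w₂ d x.1 x.2 s

/-- `𝔈` is defined on `d` over the rectangle `(a₁, b₁) × (a₂, b₂)`, with values in `L¹`: its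
integral converges absolutely at almost every point, and the result is integrable. -/
def MlOpDefinedOn (g : Fin 6 → ℂ) (p q υ w₁ w₂ : ℂ) (a₁ b₁ a₂ b₂ : ℝ) (d : ℝ × ℝ → ℂ) : Prop :=
  (∀ᵐ x ∂(volume.restrict (Set.Ioo a₁ b₁ ×ˢ Set.Ioo a₂ b₂)),
    IntegrableOn (mlIntegrand g p q υ w₁ w₂ d x.1 x.2) (Set.Ioo a₁ x.1 ×ˢ Set.Ioo a₂ x.2)) ∧
  IntegrableOn (mlOp g p q υ w₁ w₂ a₁ a₂ d) (Set.Ioo a₁ b₁ ×ˢ Set.Ioo a₂ b₂)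

/-- The integrand of the double Riemann-Liouville integral of orders `α` (in `z`), `β` (in `t`),
without the Gamma factors. -/
def rlIntegrand (α β : ℂ) (f : ℝ × ℝ → ℂ) (z t : ℝ) (s : ℝ × ℝ) : ℂ :=
  ((z - s.1 : ℝ) : ℂ) ^ (α - 1) * ((t - s.2 : ℝ) : ℂ) ^ (β - 1) * f s

/-- The double Riemann-Liouville fractional integral, of order `α` in `z` and `β` in `t`. -/
def rlInt (α β : ℂ) (a₁ a₂ : ℝ) (f : ℝ × ℝ → ℂ) (z t : ℝ) : ℂ :=
  1 / (Complex.Gamma α * Complex.Gamma β) *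
    ∫ s in Set.Ioo a₁ z ×ˢ Set.Ioo a₂ t, rlIntegrand α β f z t s

/-- The integer `[Re α] + 1`. -/
def rlOrder (α : ℂ) : ℕ := ⌊α.re⌋₊ + 1

/-- The double Riemann-Liouville fractional derivative, of order `α` in `z` and `β` in `t`:
`∂ₜ^r ∂_z^n` of the fractional integral of orders `n - α`, `r - β`, where `n = [Re α] + 1` and
`r = [Re β] + 1`. -/
def rlDeriv (α β : ℂ) (a₁ a₂ : ℝ) (f : ℝ × ℝ → ℂ) (x : ℝ × ℝ) : ℂ :=
  iteratedDeriv (rlOrder β)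
    (fun t => iteratedDeriv (rlOrder α)
      (fun z => rlInt (rlOrder α - α) (rlOrder β - β) a₁ a₂ f z t) x.1) x.2

/-- `f` is `n` times differentiable at `x`: the derivatives of order below `n` exist near `x`, and
the one of order `n` exists at `x`. -/
def IterDifferentiableAt (n : ℕ) (f : ℝ → ℂ) (x : ℝ) : Prop :=
  (∀ k, k + 1 < n → ∀ᶠ y in 𝓝 x, DifferentiableAt ℝ (iteratedDeriv k f) y) ∧
  (∀ k, k + 1 = n → DifferentiableAt ℝ (iteratedDeriv k f) x)

/-- Every integral and every derivative in `rlDeriv α β a₁ a₂ f x` exists. -/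
def RlDerivExistsAt (α β : ℂ) (a₁ a₂ : ℝ) (f : ℝ × ℝ → ℂ) (x : ℝ × ℝ) : Prop :=
  (∀ᶠ u in 𝓝 x, IntegrableOn (rlIntegrand (rlOrder α - α) (rlOrder β - β) f u.1 u.2)
    (Set.Ioo a₁ u.1 ×ˢ Set.Ioo a₂ u.2)) ∧
  (∀ᶠ t in 𝓝 x.2, IterDifferentiableAt (rlOrder α)
    (fun z => rlInt (rlOrder α - α) (rlOrder β - β) a₁ a₂ f z t) x.1) ∧
  IterDifferentiableAt (rlOrder β)
    (fun t => iteratedDeriv (rlOrder α)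
      (fun z => rlInt (rlOrder α - α) (rlOrder β - β) a₁ a₂ f z t) x.1) x.2

/-- The operator `𝔻`: the double fractional derivative of orders `p + σ`, `q + τ` composed with
`𝔈` of orders `σ`, `τ` at the negated parameters. -/
def leftInvOp (γ₁ γ₂ γ₃ p q σ τ υ w₁ w₂ : ℂ) (a₁ a₂ : ℝ) (φ : ℝ × ℝ → ℂ) : ℝ × ℝ → ℂ :=
  rlDeriv (p + σ) (q + τ) a₁ a₂
    (mlOp (tiedParams (-γ₁) (-γ₂) (-γ₃)) σ τ υ w₁ w₂ a₁ a₂ φ)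

end IKonhauser

end

noncomputable section

namespace IKonhauser

/-! ### Pochhammer symbols -/

/-! At tied parameters the coefficient collapses: the duplication formula
$(\gamma_1)_{2l}=4^l(\gamma_1/2)_l(\frac{\gamma_1+1}2)_l$ cancels the denominator and leaves
$4^l(\gamma_1/2)_l(\gamma_2+l)_m$, a polynomial in the parameters (`mlCoeff_tiedParams`). With
$k_\alpha(u)=u^{\alpha-1}/\Gamma(\alpha)$, the kernel of $\mathfrak E$ is then $\sum
c_{l,m}(a,b)\,x^ly^m\,k_{p+l}\otimes k_{q+\upsilon m}$ for $a=\gamma_1/2$, $b=\gamma_2$, $x=-4w_1$,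
$y=w_2^\upsilon$, where $\sum c_{l,m}(a,b)X^lY^m=(1-Y)^{-b}\bigl(1-\frac X{1-Y}\bigr)^{-a}$.

Since $k_\alpha*k_\beta=k_{\alpha+\beta}$ (the Beta integral), convolving two such kernels
multiplies their generating functions. Negating $a,b$ inverts the generating function, so the two
kernels convolve to the single product $k_{p+\sigma}\otimes k_{q+\tau}$
(`tsum_serCoeff_mul_serCoeff_neg`, `integral_mlKer_mul_mlKer_neg`). Hence the second operator
applied to $\varphi$ is almost everywhere the Riemann–Liouville integral of $d$ of orders
$(p+\sigma,q+\tau)$ (`volterra_comp_ae`), and the Riemann–Liouville derivative inverts that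
(`rlDeriv_of_ae_eq_volterra`).

The analytic work lies in three places. Convergence for complex $\upsilon$ needs lower bounds for
$|\Gamma|$ off the real axis (`summable_pow_div_norm_Gamma`). Before differentiating, the
composition identity must hold at every point of $R$, not almost everywhere; this works because the
total orders are positive integers and the composed kernels are bounded
(`volterra_comp_of_bounded`). Finally, the $z$-derivatives must exist at one $z$ for all nearby $t$
at once, which follows from Lebesgue points of the $L^1$-valued map $z\mapsto d(z,\cdot)$
(`ae_hasDerivAt_integral_slices`). -/

@[simp] lemma poch_zero (a : ℂ) : poch a 0 = 1 := by simp [poch]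

lemma poch_succ (a : ℂ) (n : ℕ) : poch a (n + 1) = poch a n * (a + n) := by
  simp [poch, ascPochhammer_succ_right, Polynomial.eval_add]

lemma poch_eq_prod (a : ℂ) (n : ℕ) : poch a n = ∏ j ∈ Finset.range n, (a + j) := by
  induction n with
  | zero => simp
  | succ n ih => rw [poch_succ, ih, Finset.prod_range_succ]

lemma poch_add (a : ℂ) (l m : ℕ) : poch a (l + m) = poch a l * poch (a + l) m := by
  simp only [poch_eq_prod, Finset.prod_range_add]
  congr 1
  exact Finset.prod_congr rfl fun j _ => by push_cast; ring

/-- Splits the product into even and odd factors; the second half is what cancels $(\gamma_4)_l$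
when $\gamma_4=(\gamma_1+1)/2$. -/
lemma poch_two_mul (a : ℂ) (l : ℕ) :
    poch a (2 * l) = 4 ^ l * poch (a / 2) l * poch ((a + 1) / 2) l := by
  induction l with
  | zero => simp
  | succ l ih =>
    rw [show 2 * (l + 1) = 2 * l + 1 + 1 by ring, poch_succ, poch_succ, ih, poch_succ, poch_succ]
    push_cast
    ring

lemma poch_zero_left (n : ℕ) : poch 0 n = if n = 0 then 1 else 0 := by
  simp [poch, ascPochhammer_eval_zero]

lemma continuous_poch (n : ℕ) : Continuous fun a => poch a n :=
  (ascPochhammer ℂ n).continuous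

/-- Each factor vanishes for at most one value of ε, so the shifted denominators are nonzero in a
punctured neighbourhood of 0. -/
lemma eventually_poch_add_ne_zero (a : ℂ) (n : ℕ) : ∀ᶠ ε in 𝓝[≠] (0 : ℂ), poch (a + ε) n ≠ 0 := by
  simp only [poch_eq_prod, Finset.prod_ne_zero_iff]
  rw [Filter.eventually_all_finset]
  intro j _
  by_cases h : a + j = 0
  · filter_upwards [self_mem_nhdsWithin] with ε hε
    rwa [show a + ε + j = ε by linear_combination h]
  · have hc : Continuous fun ε : ℂ => a + ε + j := by fun_prop
    exact (hc.tendsto' 0 (a + j) (by simp)).eventually_ne h |>.filter_mono nhdsWithin_le_nhds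

/-- The Chu–Vandermonde identity, with binomial coefficients. -/
lemma sum_antidiagonal_choose_mul_poch (a b : ℂ) (n : ℕ) :
    ∑ i ∈ Finset.HasAntidiagonal.antidiagonal n, (n.choose i.1 : ℂ) * (poch a i.1 * poch b i.2)
      = poch (a + b) n := by
  induction n with
  | zero => simp
  | succ n ih =>
    rw [Finset.sum_antidiagonal_choose_succ_mul (fun i j => poch a i * poch b j), poch_succ, ← ih,
      Finset.sum_mul]
    -- By symmetry of the binomial both sums carry the same weight; they then combine through
    -- $(a+i)+(b+j)=a+b+n$.
    have h : ∑ i ∈ Finset.HasAntidiagonal.antidiagonal n, (n.choose i.2 : ℂ) * (poch a (i.1 + 1) * poch b i.2)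
        = ∑ i ∈ Finset.HasAntidiagonal.antidiagonal n, (n.choose i.1 : ℂ) * (poch a (i.1 + 1) * poch b i.2) := by
      refine Finset.sum_congr rfl fun i hi => ?_
      rw [← Finset.HasAntidiagonal.mem_antidiagonal.mp hi, Nat.choose_symm_add]
    rw [h, ← Finset.sum_add_distrib]
    refine Finset.sum_congr rfl fun i hi => ?_
    rw [← Finset.HasAntidiagonal.mem_antidiagonal.mp hi, poch_succ, poch_succ]
    push_cast
    ring

/-- The Chu–Vandermonde identity, divided by factorials. -/
lemma sum_antidiagonal_poch_div_factorial (a b : ℂ) (n : ℕ) :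
    ∑ i ∈ Finset.HasAntidiagonal.antidiagonal n, poch a i.1 / i.1.factorial * (poch b i.2 / i.2.factorial)
      = poch (a + b) n / n.factorial := by
  rw [← sum_antidiagonal_choose_mul_poch, Finset.sum_div]
  refine Finset.sum_congr rfl fun i hi => ?_
  rw [← Finset.HasAntidiagonal.mem_antidiagonal.mp hi]
  have h := congrArg (Nat.cast : ℕ → ℂ) (Nat.add_choose_mul_factorial_mul_factorial i.1 i.2)
  rw [← Nat.choose_symm_add] at h
  push_cast at h
  have h1 : (i.1.factorial : ℂ) ≠ 0 := by exact_mod_cast i.1.factorial_ne_zero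
  have h2 : (i.2.factorial : ℂ) ≠ 0 := by exact_mod_cast i.2.factorial_ne_zero
  have h3 : ((i.1 + i.2).factorial : ℂ) ≠ 0 := by exact_mod_cast (i.1 + i.2).factorial_ne_zero
  field_simp
  rw [← h]
  ring

/-- Factorwise comparison with the rising factorial $(N+1)_n=n!\binom{N+n}{n}$. -/
lemma norm_poch_le (a : ℂ) {N : ℕ} (hN : ‖a‖ ≤ N) (n : ℕ) :
    ‖poch a n‖ ≤ n.factorial * 2 ^ (N + n) := by
  have h : ‖poch a n‖ ≤ ((N + 1).ascFactorial n : ℕ) := by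
    rw [poch_eq_prod, Nat.ascFactorial_eq_prod_range, norm_prod]
    push_cast
    refine Finset.prod_le_prod (fun _ _ => norm_nonneg _) fun j _ => ?_
    refine (norm_add_le _ _).trans ?_
    simp only [Complex.norm_natCast]
    linarith
  refine h.trans ?_
  rw [Nat.ascFactorial_eq_factorial_mul_choose]
  exact_mod_cast Nat.mul_le_mul_left _ (Nat.choose_le_two_pow _ _)

lemma norm_poch_div_factorial_le (a : ℂ) {N : ℕ} (hN : ‖a‖ ≤ N) (n : ℕ) :
    ‖poch a n / n.factorial‖ ≤ 2 ^ (N + n) := by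
  rw [norm_div, Complex.norm_natCast, div_le_iff₀ (by exact_mod_cast n.factorial_pos), mul_comm]
  exact norm_poch_le a hN n

/-! ### The coefficients at tied parameters -/

lemma pochQuot_tiedParams (γ₁ γ₂ γ₃ : ℂ) (l m : ℕ)
    (h : poch ((γ₁ + 1) / 2) l * poch γ₂ l * poch γ₃ l ≠ 0) :
    pochQuot (tiedParams γ₁ γ₂ γ₃) l m = 4 ^ l * poch (γ₁ / 2) l * poch (γ₂ + l) m := by
  rw [pochQuot]
  change poch γ₁ (2 * l) * poch γ₂ (l + m) * poch γ₃ l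
    / (poch ((γ₁ + 1) / 2) l * poch γ₂ l * poch γ₃ l) = _
  rw [div_eq_iff h, poch_two_mul, poch_add]
  ring

lemma tiedParams_add (γ₁ γ₂ γ₃ ε : ℂ) :
    (fun i => tiedParams γ₁ γ₂ γ₃ i + (![2, 1, 1, 1, 1, 1] : Fin 6 → ℂ) i * ε)
      = tiedParams (γ₁ + 2 * ε) (γ₂ + ε) (γ₃ + ε) := by
  funext i
  fin_cases i <;> simp [tiedParams]
  ring

/-- The closed form is continuous in the parameters and agrees with the quotient at all small
nonzero ε, so the reading by continuity gives the same formula where the denominator vanishes. -/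
lemma mlCoeff_tiedParams (γ₁ γ₂ γ₃ : ℂ) (l m : ℕ) :
    mlCoeff (tiedParams γ₁ γ₂ γ₃) l m = 4 ^ l * poch (γ₁ / 2) l * poch (γ₂ + l) m := by
  rw [mlCoeff]
  split_ifs with h
  · exact pochQuot_tiedParams _ _ _ _ _ h
  · refine Tendsto.limUnder_eq ?_
    simp only [tiedParams_add]
    have hc : Continuous fun ε : ℂ =>
        4 ^ l * poch ((γ₁ + 2 * ε) / 2) l * poch (γ₂ + ε + l) m := by
      refine (continuous_const.mul ((continuous_poch l).comp ?_)).mul ((continuous_poch m).comp ?_)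
      <;> fun_prop
    refine Tendsto.congr' ?_ ((hc.tendsto' 0 _ (by simp)).mono_left nhdsWithin_le_nhds)
    filter_upwards [eventually_poch_add_ne_zero ((γ₁ + 1) / 2) l, eventually_poch_add_ne_zero γ₂ l,
      eventually_poch_add_ne_zero γ₃ l] with ε h1 h2 h3
    rw [pochQuot_tiedParams]
    rw [show (γ₁ + 2 * ε + 1) / 2 = (γ₁ + 1) / 2 + ε by ring]
    exact mul_ne_zero (mul_ne_zero h1 h2) h3

/-! ### Lower bounds for the Gamma function -/

/-- In Euler's product the powers of $n$ and the factorials cancel, and each factor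
$|s+i\tau|/s=\sqrt{1+\tau^2/s^2}$ decreases in $s=x+j$. -/
lemma norm_GammaSeq_ofReal_add_mul_I_ge {x y τ : ℝ} (hx : 0 < x) (hxy : x ≤ y) {n : ℕ} (hn : n ≠ 0) :
    ‖Complex.GammaSeq (x + τ * Complex.I) n‖ * ‖Complex.GammaSeq y n‖
      ≤ ‖Complex.GammaSeq (y + τ * Complex.I) n‖ * ‖Complex.GammaSeq x n‖ := by
  have hn' : 0 < n := Nat.pos_of_ne_zero hn
  simp only [Complex.GammaSeq, norm_div, norm_mul, norm_prod, Complex.norm_natCast_cpow_of_pos hn',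
    Complex.norm_natCast]
  simp only [Complex.add_re, Complex.ofReal_re, Complex.mul_re, Complex.I_re, mul_zero,
    Complex.ofReal_im, Complex.I_im, zero_mul, sub_zero, add_zero]
  have key : ∀ j : ℕ, ‖(y : ℂ) + τ * Complex.I + j‖ * ‖(x : ℂ) + j‖
      ≤ ‖(x : ℂ) + τ * Complex.I + j‖ * ‖(y : ℂ) + j‖ := by
    intro j
    rw [← norm_mul, ← norm_mul, ← sq_le_sq₀ (norm_nonneg _) (norm_nonneg _), Complex.sq_norm,
      Complex.sq_norm, Complex.normSq_mul, Complex.normSq_mul]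
    simp only [Complex.normSq_apply]
    simp
    have h1 : 0 < x + j := by positivity
    have h2 : x + j ≤ y + j := by linarith
    nlinarith [mul_nonneg (sq_nonneg τ) (sub_nonneg.2 (mul_self_le_mul_self h1.le h2))]
  have hp : ∀ z : ℂ, 0 < z.re → ∀ j : ℕ, 0 < ‖z + j‖ := by
    intro z hz j
    refine norm_pos_iff.2 fun h => ?_
    have := congrArg Complex.re h
    simp at this
    have : (0 : ℝ) ≤ j := by positivity
    linarith
  have hprod : (∏ j ∈ Finset.range (n + 1), ‖(y : ℂ) + τ * Complex.I + j‖)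
      * (∏ j ∈ Finset.range (n + 1), ‖(x : ℂ) + j‖)
      ≤ (∏ j ∈ Finset.range (n + 1), ‖(x : ℂ) + τ * Complex.I + j‖)
      * (∏ j ∈ Finset.range (n + 1), ‖(y : ℂ) + j‖) := by
    rw [← Finset.prod_mul_distrib, ← Finset.prod_mul_distrib]
    exact Finset.prod_le_prod (fun _ _ => by positivity) fun j _ => key j
  have p1 : 0 < ∏ j ∈ Finset.range (n + 1), ‖(x : ℂ) + τ * Complex.I + j‖ :=
    Finset.prod_pos fun j _ => hp _ (by simpa using hx) j
  have p2 : 0 < ∏ j ∈ Finset.range (n + 1), ‖(y : ℂ) + τ * Complex.I + j‖ :=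
    Finset.prod_pos fun j _ => hp _ (by simpa using hx.trans_le hxy) j
  have p3 : 0 < ∏ j ∈ Finset.range (n + 1), ‖(x : ℂ) + j‖ :=
    Finset.prod_pos fun j _ => hp _ (by simpa using hx) j
  have p4 : 0 < ∏ j ∈ Finset.range (n + 1), ‖(y : ℂ) + j‖ :=
    Finset.prod_pos fun j _ => hp _ (by simpa using hx.trans_le hxy) j
  rw [div_mul_div_comm, div_mul_div_comm, div_le_div_iff₀ (by positivity) (by positivity)]
  have : 0 ≤ (n : ℝ) ^ x * n.factorial * ((n : ℝ) ^ y * n.factorial) := by positivity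
  nlinarith [mul_le_mul_of_nonneg_left hprod this]

/-- Says that $|\Gamma(x+i\tau)|/\Gamma(x)$ increases with $x$, so lower bounds to the right of a
vertical line follow from those on it. -/
lemma norm_Gamma_ofReal_add_mul_I_ge {x y : ℝ} (τ : ℝ) (hx : 0 < x) (hxy : x ≤ y) :
    ‖Complex.Gamma (x + τ * Complex.I)‖ * Real.Gamma y
      ≤ ‖Complex.Gamma (y + τ * Complex.I)‖ * Real.Gamma x := by
  have e : ∀ z : ℝ, 0 < z → Real.Gamma z = ‖Complex.Gamma z‖ := by
    intro z hz
    rw [Complex.Gamma_ofReal, Complex.norm_real, Real.norm_of_nonneg (Real.Gamma_pos_of_pos hz).le]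
  rw [e x hx, e y (hx.trans_le hxy)]
  refine le_of_tendsto_of_tendsto
    ((Complex.GammaSeq_tendsto_Gamma _).norm.mul (Complex.GammaSeq_tendsto_Gamma _).norm)
    ((Complex.GammaSeq_tendsto_Gamma _).norm.mul (Complex.GammaSeq_tendsto_Gamma _).norm) ?_
  filter_upwards [eventually_ne_atTop 0] with n hn
  exact norm_GammaSeq_ofReal_add_mul_I_ge hx hxy hn

/-- On the line $\mathrm{Re}\,s=\frac12$ one has $1-s=\bar s$, so the reflection formula computes
$|\Gamma(s)|^2$. -/
lemma norm_Gamma_half_add_mul_I_sq (τ : ℝ) :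
    ‖Complex.Gamma ((1 / 2 : ℝ) + τ * Complex.I)‖ ^ 2 = Real.pi / Real.cosh (Real.pi * τ) := by
  have h := Complex.Gamma_mul_Gamma_one_sub ((1 / 2 : ℝ) + τ * Complex.I)
  have hconj : (1 : ℂ) - ((1 / 2 : ℝ) + τ * Complex.I)
      = (starRingEnd ℂ) ((1 / 2 : ℝ) + τ * Complex.I) := by
    apply Complex.ext <;> simp
    norm_num
  have hsin : Complex.sin (Real.pi * ((1 / 2 : ℝ) + τ * Complex.I))
      = (Real.cosh (Real.pi * τ) : ℝ) := by
    rw [show (Real.pi : ℂ) * ((1 / 2 : ℝ) + τ * Complex.I)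
      = ((Real.pi * τ : ℝ) : ℂ) * Complex.I + Real.pi / 2 by push_cast; ring,
      Complex.sin_add_pi_div_two, Complex.cos_mul_I, Complex.ofReal_cosh]
  rw [hconj, Complex.Gamma_conj, Complex.mul_conj, hsin] at h
  rw [Complex.sq_norm]
  exact_mod_cast h

/-- Leaving the real axis costs at most an exponential in $|\mathrm{Im}\,s|$: transport the value at
$\frac12+i\tau$ to the right. The exponent is not sharp, but along $q+\upsilon m$ the loss is only
geometric in $m$. -/
lemma norm_Gamma_ge_mul_exp {s : ℂ} (hs : 1 / 2 ≤ s.re) :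
    Real.Gamma s.re * Real.exp (-(Real.pi * |s.im|)) ≤ ‖Complex.Gamma s‖ := by
  have h := norm_Gamma_ofReal_add_mul_I_ge s.im (by norm_num : (0 : ℝ) < 1 / 2) hs
  rw [Complex.re_add_im, Real.Gamma_one_half_eq] at h
  have hG := Real.Gamma_pos_of_pos (show 0 < s.re by linarith)
  have hpi : 0 < Real.sqrt Real.pi := Real.sqrt_pos.2 Real.pi_pos
  have hhalf : Real.exp (-(Real.pi * |s.im|)) * Real.sqrt Real.pi
      ≤ ‖Complex.Gamma ((1 / 2 : ℝ) + s.im * Complex.I)‖ := by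
    rw [← sq_le_sq₀ (by positivity) (norm_nonneg _), norm_Gamma_half_add_mul_I_sq, mul_pow,
      Real.sq_sqrt Real.pi_pos.le, ← Real.exp_nat_mul, le_div_iff₀ (Real.cosh_pos _)]
    have hcosh : Real.cosh (Real.pi * s.im) ≤ Real.exp (Real.pi * |s.im|) := by
      rw [← Real.cosh_abs, abs_mul, abs_of_pos Real.pi_pos, Real.cosh_eq]
      have : Real.exp (-(Real.pi * |s.im|)) ≤ Real.exp (Real.pi * |s.im|) :=
        Real.exp_le_exp.2 (by have := mul_nonneg Real.pi_pos.le (abs_nonneg s.im); linarith)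
      linarith
    have hle : Real.exp ((2 : ℕ) * -(Real.pi * |s.im|)) * Real.exp (Real.pi * |s.im|) ≤ 1 := by
      rw [← Real.exp_add, Real.exp_le_one_iff]
      have := mul_nonneg Real.pi_pos.le (abs_nonneg s.im)
      push_cast
      linarith
    have := mul_le_mul_of_nonneg_left hcosh (Real.exp_pos ((2 : ℕ) * -(Real.pi * |s.im|))).le
    nlinarith [Real.pi_pos]
  have := mul_le_mul_of_nonneg_right hhalf hG.le
  refine le_of_mul_le_mul_right ?_ hpi
  linarith

/-- Truncate Euler's integral to $t>y$ and bound $t^{x-1}$ below by $y^{x-1}$. As $y$ is free, Γ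
outgrows every geometric sequence. -/
lemma rpow_mul_exp_neg_le_Gamma {x y : ℝ} (hx : 1 ≤ x) (hy : 0 < y) :
    y ^ (x - 1) * Real.exp (-y) ≤ Real.Gamma x := by
  rw [Real.Gamma_eq_integral (by linarith)]
  have hint := Real.GammaIntegral_convergent (show 0 < x by linarith)
  calc y ^ (x - 1) * Real.exp (-y) = ∫ t in Set.Ioi y, Real.exp (-t) * y ^ (x - 1) := by
        rw [integral_mul_const, integral_exp_neg_Ioi, mul_comm]
    _ ≤ ∫ t in Set.Ioi y, Real.exp (-t) * t ^ (x - 1) := by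
        refine setIntegral_mono_on ((integrableOn_exp_neg_Ioi y).mul_const _)
          (hint.mono_set (Set.Ioi_subset_Ioi hy.le)) measurableSet_Ioi fun t ht => ?_
        have := Real.rpow_le_rpow hy.le (le_of_lt ht) (show 0 ≤ x - 1 by linarith)
        gcongr
    _ ≤ _ := by
        refine setIntegral_mono_set hint ?_ (Set.Ioi_subset_Ioi hy.le).eventuallyLE
        filter_upwards [ae_restrict_mem measurableSet_Ioi] with t ht
        have : 0 < t := ht
        simp only [Pi.zero_apply]
        positivity

/-- `1 / Γ` decays faster than geometrically along a ray in the right half-plane. -/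
lemma summable_pow_div_norm_Gamma {q υ : ℂ} (hυ : 0 < υ.re) (X : ℝ) :
    Summable fun m : ℕ => X ^ m / ‖Complex.Gamma (q + υ * m)‖ := by
  -- `B` absorbs both $|X|$ and the geometric loss from $\mathrm{Im}\,\upsilon$. Choosing
  -- $y^{\mathrm{Re}\,\upsilon}=2B$ makes the lower bound for Γ grow like $(2B)^m$ against a
  -- numerator $B^m$, which leaves the ratio $\frac12$.
  set B := |X| * Real.exp (Real.pi * |υ.im|) + 1 with hB
  have hBpos : 0 < B := by positivity
  set y := (2 * B) ^ (1 / υ.re) with hy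
  have hypos : 0 < y := by positivity
  have hyr : y ^ υ.re = 2 * B := by
    rw [hy, ← Real.rpow_mul (by positivity), one_div_mul_cancel hυ.ne', Real.rpow_one]
  set C := Real.exp y * Real.exp (Real.pi * |q.im|) / y ^ (q.re - 1) with hC
  have hCpos : 0 < C := by positivity
  have hgeom : Summable fun m : ℕ => C * (1 / 2 : ℝ) ^ m :=
    (summable_geometric_of_lt_one (by norm_num) (by norm_num)).mul_left C
  refine Summable.of_norm_bounded_eventually_nat hgeom ?_
  have hre : Tendsto (fun m : ℕ => q.re + υ.re * m) atTop atTop :=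
    tendsto_atTop_add_const_left _ _ (tendsto_natCast_atTop_atTop.const_mul_atTop hυ)
  filter_upwards [hre.eventually_ge_atTop 1] with m hm
  have hsre : (q + υ * m).re = q.re + υ.re * m := by simp
  have hsim : (q + υ * m).im = q.im + υ.im * m := by simp
  have h1 := norm_Gamma_ge_mul_exp (s := q + υ * m) (by rw [hsre]; linarith)
  have h2 := rpow_mul_exp_neg_le_Gamma hm hypos
  rw [hsre, hsim] at h1
  have him : Real.exp (-(Real.pi * (|q.im| + |υ.im| * m)))
      ≤ Real.exp (-(Real.pi * |q.im + υ.im * m|)) := by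
    have : |q.im + υ.im * m| ≤ |q.im| + |υ.im| * m := by
      refine (abs_add_le _ _).trans ?_
      rw [abs_mul, Nat.abs_cast]
    have := mul_le_mul_of_nonneg_left this Real.pi_pos.le
    exact Real.exp_le_exp.2 (by linarith)
  have hG : y ^ (q.re - 1) * (2 * B) ^ m * Real.exp (-y)
      * Real.exp (-(Real.pi * (|q.im| + |υ.im| * m))) ≤ ‖Complex.Gamma (q + υ * m)‖ := by
    refine le_trans ?_ h1
    have e : y ^ (q.re - 1) * (2 * B) ^ m = y ^ (q.re + υ.re * m - 1) := by
      rw [← hyr, ← Real.rpow_natCast (y ^ υ.re), ← Real.rpow_mul hypos.le, ← Real.rpow_add hypos]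
      ring_nf
    rw [e]
    exact mul_le_mul h2 him (by positivity)
      (Real.Gamma_pos_of_pos (by linarith)).le
  have hlow : 0 < y ^ (q.re - 1) * (2 * B) ^ m * Real.exp (-y)
      * Real.exp (-(Real.pi * (|q.im| + |υ.im| * m))) := by positivity
  have hGpos := hlow.trans_le hG
  rw [norm_div, norm_pow, norm_norm, Real.norm_eq_abs, div_le_iff₀ hGpos]
  refine le_trans ?_ (mul_le_mul_of_nonneg_left hG (by positivity))
  have hXB : |X| ^ m * Real.exp (Real.pi * |υ.im| * m) ≤ B ^ m := by
    rw [mul_comm (Real.pi * |υ.im|), Real.exp_nat_mul, ← mul_pow]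
    exact pow_le_pow_left₀ (by positivity) (by linarith) m
  have hE : C * (1 / 2) ^ m * (y ^ (q.re - 1) * (2 * B) ^ m * Real.exp (-y)
      * Real.exp (-(Real.pi * (|q.im| + |υ.im| * m))))
      = B ^ m * Real.exp (-(Real.pi * |υ.im| * m)) := by
    have a1 : Real.exp y * Real.exp (-y) = 1 := by rw [← Real.exp_add]; simp
    have a2 : Real.exp (-(Real.pi * (|q.im| + |υ.im| * m)))
      = Real.exp (-(Real.pi * |q.im|)) * Real.exp (-(Real.pi * |υ.im| * m)) := by
      rw [← Real.exp_add]; ring_nf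
    have a3 : Real.exp (Real.pi * |q.im|) * Real.exp (-(Real.pi * |q.im|)) = 1 := by
      rw [← Real.exp_add]; simp
    have a4 : (1 / 2 : ℝ) ^ m * (2 * B) ^ m = B ^ m := by rw [← mul_pow]; congr 1; ring
    have a5 : C * y ^ (q.re - 1) = Real.exp y * Real.exp (Real.pi * |q.im|) := by
      rw [hC]; field_simp
    calc _ = (C * y ^ (q.re - 1)) * ((1 / 2 : ℝ) ^ m * (2 * B) ^ m) * Real.exp (-y)
          * Real.exp (-(Real.pi * (|q.im| + |υ.im| * m))) := by ring
      _ = (Real.exp y * Real.exp (-y))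
          * (Real.exp (Real.pi * |q.im|) * Real.exp (-(Real.pi * |q.im|)))
          * (B ^ m * Real.exp (-(Real.pi * |υ.im| * m))) := by rw [a5, a4, a2]; ring
      _ = _ := by rw [a1, a3]; ring
  rw [hE]
  have h5 : |X| ^ m = |X| ^ m * Real.exp (Real.pi * |υ.im| * m)
      * Real.exp (-(Real.pi * |υ.im| * m)) := by
    rw [mul_assoc, ← Real.exp_add]; simp
  rw [h5]
  gcongr

/-! ### The series -/

/-- The coefficient of `x ^ l * y ^ m` in `(1 - y) ^ (-b) * (1 - x / (1 - y)) ^ (-a)`. -/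
def serCoeff (a b : ℂ) (l m : ℕ) : ℂ :=
  poch a l / l.factorial * (poch (b + l) m / m.factorial)

lemma exists_norm_serCoeff_le (a b : ℂ) :
    ∃ C : ℝ, 0 ≤ C ∧ ∀ l m, ‖serCoeff a b l m‖ ≤ C * (4 ^ l * 2 ^ m) := by
  obtain ⟨N, hN⟩ := exists_nat_ge ‖a‖
  obtain ⟨M, hM⟩ := exists_nat_ge ‖b‖
  refine ⟨2 ^ N * 2 ^ M, by positivity, fun l m => ?_⟩
  -- The shift by `l` costs a further $2^l$ in the second factor; together with the first factor
  -- this gives $4^l$.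
  have hl : ‖b + l‖ ≤ ((M + l : ℕ) : ℝ) := by
    refine (norm_add_le _ _).trans ?_
    rw [Complex.norm_natCast]
    push_cast
    linarith
  rw [serCoeff, norm_mul]
  refine (mul_le_mul (norm_poch_div_factorial_le a hN l) (norm_poch_div_factorial_le _ hl m)
    (norm_nonneg _) (by positivity)).trans_eq ?_
  rw [show (4 : ℝ) = 2 * 2 by norm_num, mul_pow]
  ring

lemma mlTerm_tiedParams (γ₁ γ₂ γ₃ p q υ z t : ℂ) (l m : ℕ) :
    mlTerm (tiedParams γ₁ γ₂ γ₃) p q υ z t l m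
      = serCoeff (γ₁ / 2) γ₂ l m * (-4 * z) ^ l * (t ^ υ) ^ m
        / (Complex.Gamma (p + l) * Complex.Gamma (q + υ * m)) := by
  rw [mlTerm, mlCoeff_tiedParams, serCoeff, Complex.cpow_mul_nat, mul_pow,
    show (-4 : ℂ) = (-1) * 4 by norm_num, mul_pow]
  simp only [div_eq_mul_inv, mul_inv]
  ring

lemma summable_norm_serCoeff_mul {p q υ : ℂ} (hυ : 0 < υ.re) (a b : ℂ) {X Y : ℝ} (hX : 0 ≤ X)
    (hY : 0 ≤ Y) :
    Summable fun i : ℕ × ℕ => ‖serCoeff a b i.1 i.2‖ * X ^ i.1 * Y ^ i.2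
      / (‖Complex.Gamma (p + i.1)‖ * ‖Complex.Gamma (q + υ * i.2)‖) := by
  obtain ⟨C, hC, hle⟩ := exists_norm_serCoeff_le a b
  have h1 : Summable fun l : ℕ => (4 * X) ^ l / ‖Complex.Gamma (p + l)‖ := by
    simpa using summable_pow_div_norm_Gamma (q := p) (υ := 1) (by simp) (4 * X)
  have h2 := summable_pow_div_norm_Gamma (q := q) hυ (2 * Y)
  refine Summable.of_nonneg_of_le (fun i => by positivity) (fun i => ?_)
    ((h1.mul_of_nonneg h2 (fun _ => by positivity) (fun _ => by positivity)).mul_left C)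
  rw [div_mul_div_comm, ← mul_div_assoc]
  refine div_le_div_of_nonneg_right ?_ (by positivity)
  calc _ ≤ C * (4 ^ i.1 * 2 ^ i.2) * X ^ i.1 * Y ^ i.2 :=
        mul_le_mul_of_nonneg_right (mul_le_mul_of_nonneg_right (hle _ _) (by positivity))
          (by positivity)
    _ = _ := by rw [mul_pow, mul_pow]; ring

lemma summable_mlTerm_tiedParams {υ : ℂ} (hυ : 0 < υ.re) (γ₁ γ₂ γ₃ p q z t : ℂ) :
    Summable fun i : ℕ × ℕ => mlTerm (tiedParams γ₁ γ₂ γ₃) p q υ z t i.1 i.2 := by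
  refine Summable.of_norm ((summable_norm_serCoeff_mul (p := p) (q := q) hυ (γ₁ / 2) γ₂
    (norm_nonneg (-4 * z)) (norm_nonneg (t ^ υ))).congr fun i => ?_)
  rw [mlTerm_tiedParams]
  simp only [norm_div, norm_mul, norm_pow]

/-! ### Riemann–Liouville kernels in one variable -/

/-- The Riemann–Liouville kernel `u ^ (α - 1) / Γ(α)`. -/
def rlKer (α : ℂ) (u : ℝ) : ℂ := (u : ℂ) ^ (α - 1) / Complex.Gamma α

lemma Gamma_ne_zero {α : ℂ} (hα : 0 < α.re) : Complex.Gamma α ≠ 0 :=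
  Complex.Gamma_ne_zero_of_re_pos hα

lemma norm_rlKer {u : ℝ} (hu : 0 < u) (α : ℂ) :
    ‖rlKer α u‖ = u ^ (α.re - 1) / ‖Complex.Gamma α‖ := by
  rw [rlKer, norm_div, Complex.norm_cpow_eq_rpow_re_of_pos hu]
  simp

/-- Reduces absolute values at complex order to real order, where the kernel is positive and its
convolution is again a Beta integral. -/
lemma norm_rlKer_eq {u : ℝ} (hu : 0 < u) (α : ℂ) (hα : 0 < α.re) :
    ‖rlKer α u‖ = Real.Gamma α.re / ‖Complex.Gamma α‖ * ‖rlKer (α.re : ℂ) u‖ := by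
  rw [norm_rlKer hu, norm_rlKer hu, Complex.ofReal_re, Complex.Gamma_ofReal, Complex.norm_real,
    Real.norm_of_nonneg (Real.Gamma_pos_of_pos hα).le]
  have := (Real.Gamma_pos_of_pos hα).ne'
  field_simp

lemma measurable_rlKer (α : ℂ) : Measurable (rlKer α) := by
  unfold rlKer
  fun_prop

lemma rlKer_ne_zero {α : ℂ} (hα : 0 < α.re) {u : ℝ} (hu : 0 < u) : rlKer α u ≠ 0 := by
  refine div_ne_zero ?_ (Gamma_ne_zero hα)
  rw [Ne, Complex.cpow_eq_zero_iff]
  exact fun h => hu.ne' (by exact_mod_cast h.1)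

lemma integrableOn_rlKer {α : ℂ} (hα : 0 < α.re) (A : ℝ) :
    IntegrableOn (rlKer α) (Set.Ioo 0 A) := by
  rcases le_or_gt A 0 with h | h
  · simp [Set.Ioo_eq_empty_of_le h]
  have := intervalIntegral.intervalIntegrable_cpow' (a := 0) (b := A) (r := α - 1) (by simpa)
  exact (((intervalIntegrable_iff_integrableOn_Ioo_of_le h.le).1 this).div_const _)

lemma integral_rlKer_mul_rlKer {α β : ℂ} (hα : 0 < α.re) (hβ : 0 < β.re) {x : ℝ} (hx : 0 < x) :
    ∫ s in Set.Ioo 0 x, rlKer α s * rlKer β (x - s) = rlKer (α + β) x := by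
  have h := Complex.betaIntegral_scaled α β hx
  rw [intervalIntegral.integral_of_le hx.le, integral_Ioc_eq_integral_Ioo] at h
  have e : ∀ s : ℝ, rlKer α s * rlKer β (x - s)
      = (s : ℂ) ^ (α - 1) * ((x : ℂ) - s) ^ (β - 1) / (Complex.Gamma α * Complex.Gamma β) := by
    intro s
    rw [rlKer, rlKer, div_mul_div_comm, Complex.ofReal_sub]
  simp only [e]
  rw [integral_div, h, Complex.Gamma_mul_Gamma_eq_betaIntegral hα hβ, rlKer]
  have h1 : Complex.Gamma (α + β) * Complex.betaIntegral α β ≠ 0 := by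
    rw [← Complex.Gamma_mul_Gamma_eq_betaIntegral hα hβ]
    exact mul_ne_zero (Gamma_ne_zero hα) (Gamma_ne_zero hβ)
  rw [mul_div_mul_right _ _ (right_ne_zero_of_mul h1)]

/-- A non-integrable function has Bochner integral 0, whereas the integral just computed is nonzero.
-/
lemma integrableOn_rlKer_mul_rlKer {α β : ℂ} (hα : 0 < α.re) (hβ : 0 < β.re) {x : ℝ} (hx : 0 < x) :
    IntegrableOn (fun s => rlKer α s * rlKer β (x - s)) (Set.Ioo 0 x) := by
  by_contra h
  have h0 := integral_rlKer_mul_rlKer hα hβ hx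
  rw [integral_undef h] at h0
  exact rlKer_ne_zero (by simpa using add_pos hα hβ) hx h0.symm

lemma integral_norm_rlKer_mul_rlKer {α β : ℂ} (hα : 0 < α.re) (hβ : 0 < β.re) {x : ℝ}
    (hx : 0 < x) :
    ∫ s in Set.Ioo 0 x, ‖rlKer α s‖ * ‖rlKer β (x - s)‖
      = Real.Gamma α.re / ‖Complex.Gamma α‖ * (Real.Gamma β.re / ‖Complex.Gamma β‖)
        * (x ^ (α.re + β.re - 1) / Real.Gamma (α.re + β.re)) := by
  have h := integral_rlKer_mul_rlKer (α := (α.re : ℂ)) (β := (β.re : ℂ)) (by simpa) (by simpa) hx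
  have e : ∀ s ∈ Set.Ioo 0 x, ‖rlKer α s‖ * ‖rlKer β (x - s)‖
      = Real.Gamma α.re / ‖Complex.Gamma α‖ * (Real.Gamma β.re / ‖Complex.Gamma β‖)
        * (rlKer (α.re : ℂ) s * rlKer (β.re : ℂ) (x - s)).re := by
    intro s hs
    have hr : ∀ (r u : ℝ), 0 < u → 0 < r → rlKer (r : ℂ) u = (‖rlKer (r : ℂ) u‖ : ℝ) := by
      intro r u hu hr
      rw [norm_rlKer hu, rlKer, Complex.Gamma_ofReal, Complex.norm_real, Real.norm_of_nonneg
        (Real.Gamma_pos_of_pos hr).le]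
      push_cast [Complex.ofReal_cpow hu.le]
      simp
    rw [norm_rlKer_eq hs.1 α hα, norm_rlKer_eq (sub_pos.2 hs.2) β hβ,
      hr _ _ hs.1 hα, hr _ _ (sub_pos.2 hs.2) hβ, ← Complex.ofReal_mul, Complex.ofReal_re]
    simp only [Complex.norm_real, norm_norm]
    ring
  rw [setIntegral_congr_fun measurableSet_Ioo e, integral_const_mul]
  congr 1
  have hre := integral_re (𝕜 := ℂ)
    (integrableOn_rlKer_mul_rlKer (α := (α.re : ℂ)) (β := (β.re : ℂ)) (by simpa) (by simpa) hx)
  simp only [RCLike.re_to_complex] at hre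
  rw [hre, h, rlKer, ← Complex.ofReal_add, Complex.Gamma_ofReal]
  rw [show ((α.re + β.re : ℝ) : ℂ) - 1 = ((α.re + β.re - 1 : ℝ) : ℂ) by push_cast; ring,
    ← Complex.ofReal_cpow hx.le, ← Complex.ofReal_div, Complex.ofReal_re]

/-! ### Mittag-Leffler kernels -/

/-- The `i`-th term of the expansion of the Mittag-Leffler kernel. -/
def kerTerm (a b p q υ x y : ℂ) (i : ℕ × ℕ) (u : ℝ × ℝ) : ℂ :=
  serCoeff a b i.1 i.2 * x ^ i.1 * y ^ i.2 * (rlKer (p + i.1) u.1 * rlKer (q + υ * i.2) u.2)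

/-- The Mittag-Leffler kernel. -/
def mlKer (a b p q υ x y : ℂ) (u : ℝ × ℝ) : ℂ := ∑' i, kerTerm a b p q υ x y i u

/-- The product of two Riemann–Liouville kernels. -/
def rlKer₂ (α β : ℂ) (u : ℝ × ℝ) : ℂ := rlKer α u.1 * rlKer β u.2

/-- A positive factor does not change the argument, so principal logarithms add; `υ ≠ 0` covers `w =
0`, where both sides vanish. -/
lemma mul_ofReal_cpow {v : ℝ} (hv : 0 < v) (w : ℂ) {υ : ℂ} (hυ : υ ≠ 0) :
    (w * v) ^ υ = w ^ υ * (v : ℂ) ^ υ := by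
  by_cases hw : w = 0
  · simp [hw, Complex.zero_cpow hυ]
  have hv' : (v : ℂ) ≠ 0 := by exact_mod_cast hv.ne'
  rw [Complex.cpow_def_of_ne_zero (mul_ne_zero hw hv'), Complex.cpow_def_of_ne_zero hw,
    Complex.cpow_def_of_ne_zero hv', ← Complex.exp_add, Complex.log_mul_ofReal v hv w hw,
    ← Complex.ofReal_log hv.le]
  ring_nf

lemma rlKer_add {u : ℝ} (hu : 0 < u) (α β : ℂ) :
    rlKer (α + β) u = (u : ℂ) ^ (α - 1) * (u : ℂ) ^ β / Complex.Gamma (α + β) := by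
  rw [rlKer, ← Complex.cpow_add _ _ (by exact_mod_cast hu.ne')]
  ring_nf

/-- The prefactor and the Gamma denominators turn each monomial of the series into a
Riemann–Liouville kernel of raised order; sign and duplication factor go into `-4 * w₁`. -/
lemma cpow_mul_mlFun_tiedParams {υ : ℂ} (hυ : 0 < υ.re) (γ₁ γ₂ γ₃ p q w₁ w₂ : ℂ) {u : ℝ × ℝ}
    (h1 : 0 < u.1) (h2 : 0 < u.2) :
    (u.1 : ℂ) ^ (p - 1) * (u.2 : ℂ) ^ (q - 1)
      * mlFun (tiedParams γ₁ γ₂ γ₃) p q υ (w₁ * u.1) (w₂ * u.2)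
      = mlKer (γ₁ / 2) γ₂ p q υ (-4 * w₁) (w₂ ^ υ) u := by
  have hυ' : υ ≠ 0 := fun h => by simp [h] at hυ
  rw [mlFun, mlKer, ← tsum_mul_left]
  refine tsum_congr fun i => ?_
  rw [mlTerm_tiedParams, kerTerm, rlKer_add h1, rlKer_add h2, mul_ofReal_cpow h2 _ hυ',
    Complex.cpow_natCast, Complex.cpow_mul_nat, ← mul_assoc, mul_pow, mul_pow _ ((u.2 : ℂ) ^ υ)]
  simp only [div_eq_mul_inv, mul_inv]
  ring

/-- The constants which dominate the Mittag-Leffler kernel on `(0, X) × (0, Y)`. -/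
def kerBound (a b p q υ x y : ℂ) (X Y : ℝ) (i : ℕ × ℕ) : ℝ :=
  ‖serCoeff a b i.1 i.2‖ * (‖x‖ * X) ^ i.1 * (‖y‖ * Y ^ υ.re) ^ i.2
    / (‖Complex.Gamma (p + i.1)‖ * ‖Complex.Gamma (q + υ * i.2)‖)

lemma summable_kerBound {υ : ℂ} (hυ : 0 < υ.re) (a b p q x y : ℂ) {X Y : ℝ} (hX : 0 ≤ X)
    (hY : 0 ≤ Y) : Summable (kerBound a b p q υ x y X Y) :=
  summable_norm_serCoeff_mul hυ a b (by positivity) (by positivity)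

lemma kerBound_nonneg (a b p q υ x y : ℂ) {X Y : ℝ} (hX : 0 ≤ X) (hY : 0 ≤ Y) (i : ℕ × ℕ) :
    0 ≤ kerBound a b p q υ x y X Y i := by
  unfold kerBound
  positivity

lemma norm_kerTerm_le {υ : ℂ} (hυ : 0 < υ.re) (a b p q x y : ℂ) {X Y : ℝ} {u : ℝ × ℝ}
    (hu : u ∈ Set.Ioo 0 X ×ˢ Set.Ioo 0 Y) (i : ℕ × ℕ) :
    ‖kerTerm a b p q υ x y i u‖
      ≤ kerBound a b p q υ x y X Y i * (u.1 ^ (p.re - 1) * u.2 ^ (q.re - 1)) := by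
  obtain ⟨⟨h1, h1'⟩, h2, h2'⟩ := hu
  have e1 : u.1 ^ ((p + i.1).re - 1) = u.1 ^ (p.re - 1) * u.1 ^ i.1 := by
    rw [← Real.rpow_natCast, ← Real.rpow_add h1]
    simp only [Complex.add_re, Complex.natCast_re]
    ring_nf
  have e2 : u.2 ^ ((q + υ * i.2).re - 1) = u.2 ^ (q.re - 1) * (u.2 ^ υ.re) ^ i.2 := by
    rw [← Real.rpow_natCast, ← Real.rpow_mul h2.le, ← Real.rpow_add h2]
    simp only [Complex.add_re, Complex.mul_re, Complex.natCast_re, Complex.natCast_im]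
    ring_nf
  simp only [kerTerm, norm_mul, norm_pow, norm_rlKer h1, norm_rlKer h2, e1, e2]
  calc _ = ‖serCoeff a b i.1 i.2‖ * (‖x‖ * u.1) ^ i.1 * (‖y‖ * u.2 ^ υ.re) ^ i.2
        / (‖Complex.Gamma (p + i.1)‖ * ‖Complex.Gamma (q + υ * i.2)‖)
          * (u.1 ^ (p.re - 1) * u.2 ^ (q.re - 1)) := by
        rw [mul_pow, mul_pow]
        simp only [div_eq_mul_inv, mul_inv]
        ring
    _ ≤ _ := by
        have hX : 0 ≤ X := (h1.trans h1').le
        unfold kerBound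
        gcongr

lemma measurable_kerTerm (a b p q υ x y : ℂ) (i : ℕ × ℕ) :
    Measurable (kerTerm a b p q υ x y i) := by
  unfold kerTerm
  exact (((measurable_rlKer _).comp measurable_fst).mul
    ((measurable_rlKer _).comp measurable_snd)).const_mul _

lemma integrableOn_rpow_mul_rpow {r s : ℝ} (hr : 0 < r) (hs : 0 < s) (X Y : ℝ) :
    IntegrableOn (fun u : ℝ × ℝ => u.1 ^ (r - 1) * u.2 ^ (s - 1))
      (Set.Ioo 0 X ×ˢ Set.Ioo 0 Y) := by
  have h : ∀ r : ℝ, 0 < r → ∀ X : ℝ, IntegrableOn (fun u : ℝ => u ^ (r - 1)) (Set.Ioo 0 X) := by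
    intro r hr X
    rcases le_or_gt X 0 with h | h
    · simp [Set.Ioo_eq_empty_of_le h]
    exact (intervalIntegrable_iff_integrableOn_Ioo_of_le h.le).1
      (intervalIntegral.intervalIntegrable_rpow' (by linarith))
  rw [IntegrableOn, Measure.volume_eq_prod, ← Measure.prod_restrict]
  exact (h r hr X).mul_prod (h s hs Y)

lemma summable_norm_kerTerm {υ : ℂ} (hυ : 0 < υ.re) (a b p q x y : ℂ) {u : ℝ × ℝ}
    (h1 : 0 < u.1) (h2 : 0 < u.2) : Summable fun i => ‖kerTerm a b p q υ x y i u‖ :=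
  Summable.of_nonneg_of_le (fun _ => norm_nonneg _)
    (norm_kerTerm_le hυ a b p q x y (X := u.1 + 1) (Y := u.2 + 1)
      ⟨⟨h1, by linarith⟩, h2, by linarith⟩)
    ((summable_kerBound hυ a b p q x y (by linarith) (by linarith)).mul_right _)

/-- The series is dominated by a constant times $u_1^{\mathrm{Re}\,p-1}u_2^{\mathrm{Re}\,q-1}$;
measurability comes from the finite partial sums. -/
lemma integrableOn_mlKer {p q υ : ℂ} (hp : 0 < p.re) (hq : 0 < q.re) (hυ : 0 < υ.re) (a b x y : ℂ)
    {X Y : ℝ} (hX : 0 ≤ X) (hY : 0 ≤ Y) :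
    IntegrableOn (mlKer a b p q υ x y) (Set.Ioo 0 X ×ˢ Set.Ioo 0 Y) := by
  have hS := summable_kerBound hυ a b p q x y hX hY
  have hmeas : MeasurableSet (Set.Ioo (0 : ℝ) X ×ˢ Set.Ioo (0 : ℝ) Y) :=
    measurableSet_Ioo.prod measurableSet_Ioo
  have hdom := (integrableOn_rpow_mul_rpow hp hq X Y).const_mul (∑' i, kerBound a b p q υ x y X Y i)
  refine Integrable.mono' hdom ?_ ?_
  · refine aestronglyMeasurable_of_tendsto_ae (atTop : Filter (Finset (ℕ × ℕ)))
      (f := fun s u => ∑ i ∈ s, kerTerm a b p q υ x y i u) (fun s => ?_) ?_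
    · exact (Finset.measurable_fun_sum s fun i _ =>
        measurable_kerTerm a b p q υ x y i).aestronglyMeasurable
    · filter_upwards [ae_restrict_mem hmeas] with u hu
      exact (summable_norm_kerTerm hυ a b p q x y hu.1.1 hu.2.1).of_norm.hasSum
  · filter_upwards [ae_restrict_mem hmeas] with u hu
    rw [mlKer, ← tsum_mul_right]
    exact tsum_of_norm_bounded (hS.mul_right _).hasSum (norm_kerTerm_le hυ a b p q x y hu)

lemma setIntegral_prod_mul' (f g : ℝ → ℂ) (s t : Set ℝ) :
    ∫ z in s ×ˢ t, f z.1 * g z.2 = (∫ x in s, f x) * ∫ y in t, g y :=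
  setIntegral_prod_mul f g s t

lemma integral_rlKer₂_mul_rlKer₂ {α β α' β' : ℂ} (hα : 0 < α.re) (hβ : 0 < β.re)
    (hα' : 0 < α'.re) (hβ' : 0 < β'.re) {u : ℝ × ℝ} (h1 : 0 < u.1) (h2 : 0 < u.2) :
    ∫ s in Set.Ioo 0 u.1 ×ˢ Set.Ioo 0 u.2, rlKer₂ α β s * rlKer₂ α' β' (u - s)
      = rlKer₂ (α + α') (β + β') u := by
  rw [rlKer₂, ← integral_rlKer_mul_rlKer hα hα' h1, ← integral_rlKer_mul_rlKer hβ hβ' h2,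
    ← setIntegral_prod_mul']
  refine integral_congr_ae (Eventually.of_forall fun s => ?_)
  simp only [rlKer₂, Prod.fst_sub, Prod.snd_sub]
  ring

lemma integrableOn_rlKer₂_mul_rlKer₂ {α β α' β' : ℂ} (hα : 0 < α.re) (hβ : 0 < β.re)
    (hα' : 0 < α'.re) (hβ' : 0 < β'.re) {u : ℝ × ℝ} (h1 : 0 < u.1) (h2 : 0 < u.2) :
    IntegrableOn (fun s => rlKer₂ α β s * rlKer₂ α' β' (u - s))
      (Set.Ioo 0 u.1 ×ˢ Set.Ioo 0 u.2) := by
  rw [IntegrableOn, Measure.volume_eq_prod, ← Measure.prod_restrict]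
  refine ((integrableOn_rlKer_mul_rlKer hα hα' h1).mul_prod
    (integrableOn_rlKer_mul_rlKer hβ hβ' h2)).congr (Eventually.of_forall fun s => ?_)
  simp only [rlKer₂, Prod.fst_sub, Prod.snd_sub]
  ring

/-- With total orders of real part at least 1 the resulting powers have nonnegative exponents, hence
stay bounded near the axes. -/
lemma integral_norm_rlKer₂_mul_rlKer₂_le {α β α' β' : ℂ} (hα : 0 < α.re) (hβ : 0 < β.re)
    (hα' : 0 < α'.re) (hβ' : 0 < β'.re) (h : 1 ≤ α.re + α'.re) (h' : 1 ≤ β.re + β'.re) (X Y : ℝ) :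
    ∃ C : ℝ, ∀ u ∈ Set.Ioo 0 X ×ˢ Set.Ioo 0 Y,
      ∫ s in Set.Ioo 0 u.1 ×ˢ Set.Ioo 0 u.2, ‖rlKer₂ α β s‖ * ‖rlKer₂ α' β' (u - s)‖ ≤ C := by
  refine ⟨Real.Gamma α.re / ‖Complex.Gamma α‖ * (Real.Gamma α'.re / ‖Complex.Gamma α'‖)
        * (X ^ (α.re + α'.re - 1) / Real.Gamma (α.re + α'.re))
      * (Real.Gamma β.re / ‖Complex.Gamma β‖ * (Real.Gamma β'.re / ‖Complex.Gamma β'‖)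
        * (Y ^ (β.re + β'.re - 1) / Real.Gamma (β.re + β'.re))), ?_⟩
  rintro u ⟨⟨h1, h1'⟩, h2, h2'⟩
  have e : ∀ s : ℝ × ℝ, ‖rlKer₂ α β s‖ * ‖rlKer₂ α' β' (u - s)‖
      = (‖rlKer α s.1‖ * ‖rlKer α' (u.1 - s.1)‖) * (‖rlKer β s.2‖ * ‖rlKer β' (u.2 - s.2)‖) := by
    intro s
    simp only [rlKer₂, Prod.fst_sub, Prod.snd_sub, norm_mul]
    ring
  simp only [e]
  rw [Measure.volume_eq_prod, setIntegral_prod_mul (fun s => ‖rlKer α s‖ * ‖rlKer α' (u.1 - s)‖)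
    (fun s => ‖rlKer β s‖ * ‖rlKer β' (u.2 - s)‖), integral_norm_rlKer_mul_rlKer hα hα' h1,
    integral_norm_rlKer_mul_rlKer hβ hβ' h2]
  have g1 := Real.Gamma_pos_of_pos hα
  have g2 := Real.Gamma_pos_of_pos hα'
  have g3 := Real.Gamma_pos_of_pos hβ
  have g4 := Real.Gamma_pos_of_pos hβ'
  have g5 := Real.Gamma_pos_of_pos (add_pos hα hα')
  have g6 := Real.Gamma_pos_of_pos (add_pos hβ hβ')
  have hX : 0 < X := h1.trans h1'
  have hY : 0 < Y := h2.trans h2'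
  have i1 := Real.rpow_le_rpow h1.le h1'.le (sub_nonneg.2 h)
  have i2 := Real.rpow_le_rpow h2.le h2'.le (sub_nonneg.2 h')
  gcongr

/-! ### The convolution of two Mittag-Leffler kernels -/

lemma tsum_eq_tsum_sum_antidiagonal {f : ℕ × ℕ → ℂ} (hf : Summable f) :
    ∑' i, f i = ∑' n, ∑ i ∈ Finset.HasAntidiagonal.antidiagonal n, f i := by
  conv_rhs => congr; ext; rw [← Finset.sum_finset_coe, ← tsum_fintype (L := .unconditional _)]
  rw [← Finset.HasAntidiagonal.sigmaAntidiagonalEquivProd.tsum_eq f]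
  exact (Finset.HasAntidiagonal.sigmaAntidiagonalEquivProd.summable_iff.2 hf).tsum_sigma'
    fun n => (hasSum_fintype _).summable

/-- This is $(1-x)^{-a}(1-x)^{-b}=(1-x)^{-a-b}$ with $x^n$ replaced by an arbitrary sequence
$\varphi(n)$: regroup by $n$ and apply Chu–Vandermonde. -/
lemma tsum_poch_mul_poch (a b c : ℂ) (φ : ℕ → ℂ)
    (h : Summable fun i : ℕ × ℕ => c * (poch a i.1 / i.1.factorial * (poch b i.2 / i.2.factorial))
      * φ (i.1 + i.2)) :
    ∑' i : ℕ × ℕ, c * (poch a i.1 / i.1.factorial * (poch b i.2 / i.2.factorial)) * φ (i.1 + i.2)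
      = c * ∑' n, poch (a + b) n / n.factorial * φ n := by
  rw [tsum_eq_tsum_sum_antidiagonal h, ← tsum_mul_left]
  refine tsum_congr fun n => ?_
  rw [← sum_antidiagonal_poch_div_factorial, ← mul_assoc, Finset.mul_sum, Finset.sum_mul]
  refine Finset.sum_congr rfl fun i hi => ?_
  rw [Finset.HasAntidiagonal.mem_antidiagonal.mp hi]

lemma tsum_poch_zero (φ : ℕ → ℂ) : ∑' n, poch 0 n / n.factorial * φ n = φ 0 := by
  rw [tsum_eq_single 0]
  · simp
  · intro n hn
    simp [poch_zero_left, hn]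

/-- The series with coefficients `serCoeff a b` and `serCoeff (-a) (-b)` are mutually inverse. -/
lemma tsum_serCoeff_mul_serCoeff_neg (a b : ℂ) (φ ψ : ℕ → ℂ)
    (h : Summable fun i : (ℕ × ℕ) × (ℕ × ℕ) => serCoeff a b i.1.1 i.1.2
      * serCoeff (-a) (-b) i.2.1 i.2.2 * φ (i.1.1 + i.2.1) * ψ (i.1.2 + i.2.2)) :
    ∑' i : (ℕ × ℕ) × (ℕ × ℕ), serCoeff a b i.1.1 i.1.2
      * serCoeff (-a) (-b) i.2.1 i.2.2 * φ (i.1.1 + i.2.1) * ψ (i.1.2 + i.2.2) = φ 0 * ψ 0 := by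
  rw [← (Equiv.prodProdProdComm ℕ ℕ ℕ ℕ).summable_iff] at h
  rw [← (Equiv.prodProdProdComm ℕ ℕ ℕ ℕ).tsum_eq]
  have e : ∀ i : (ℕ × ℕ) × (ℕ × ℕ), serCoeff a b i.1.1 i.2.1
      * serCoeff (-a) (-b) i.1.2 i.2.2 * φ (i.1.1 + i.1.2) * ψ (i.2.1 + i.2.2)
      = 1 * (poch a i.1.1 / i.1.1.factorial * (poch (-a) i.1.2 / i.1.2.factorial))
          * φ (i.1.1 + i.1.2)
        * (poch (b + i.1.1) i.2.1 / i.2.1.factorial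
          * (poch (-b + i.1.2) i.2.2 / i.2.2.factorial)) * ψ (i.2.1 + i.2.2) := by
    intro i
    simp only [serCoeff]
    ring
  simp only [Function.comp_def, Equiv.prodProdProdComm_apply, e] at h ⊢
  rw [h.tsum_prod]
  -- The parameters $b+j_1$ and $-b+j_2$ add up to $j_1+j_2$, so the inner sum depends on $j$ only
  -- through $L=j_1+j_2$. The outer sum then has total parameter $a-a=0$, which leaves $L=0$, and
  -- with it the inner sum reduces to $n=0$.
  have inner : ∀ j : ℕ × ℕ, ∑' i : ℕ × ℕ,
      1 * (poch a j.1 / j.1.factorial * (poch (-a) j.2 / j.2.factorial)) * φ (j.1 + j.2)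
        * (poch (b + j.1) i.1 / i.1.factorial * (poch (-b + j.2) i.2 / i.2.factorial))
          * ψ (i.1 + i.2)
      = 1 * (poch a j.1 / j.1.factorial * (poch (-a) j.2 / j.2.factorial))
        * (fun L : ℕ => φ L * ∑' n, poch (L : ℂ) n / n.factorial * ψ n) (j.1 + j.2) := by
    intro j
    refine (tsum_poch_mul_poch (b + j.1) (-b + j.2)
      (1 * (poch a j.1 / j.1.factorial * (poch (-a) j.2 / j.2.factorial)) * φ (j.1 + j.2)) ψ
      (h.prod_factor j)).trans ?_
    rw [show b + (j.1 : ℂ) + (-b + j.2) = ((j.1 + j.2 : ℕ) : ℂ) by push_cast; ring, mul_assoc]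
  have h2 := h.prod
  rw [funext inner] at h2 ⊢
  refine (tsum_poch_mul_poch a (-a) 1
    (fun L : ℕ => φ L * ∑' n, poch (L : ℂ) n / n.factorial * ψ n) h2).trans ?_
  rw [add_neg_cancel, tsum_poch_zero, Nat.cast_zero, tsum_poch_zero, one_mul]

lemma integral_kerTerm_mul_kerTerm {p q σ τ υ : ℂ} (hp : 0 < p.re) (hq : 0 < q.re) (hσ : 0 < σ.re)
    (hτ : 0 < τ.re) (hυ : 0 < υ.re) (a b a' b' x y : ℂ) {u : ℝ × ℝ} (h1 : 0 < u.1) (h2 : 0 < u.2)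
    (i j : ℕ × ℕ) :
    ∫ s in Set.Ioo 0 u.1 ×ˢ Set.Ioo 0 u.2,
      kerTerm a b p q υ x y i s * kerTerm a' b' σ τ υ x y j (u - s)
      = serCoeff a b i.1 i.2 * serCoeff a' b' j.1 j.2
        * (x ^ (i.1 + j.1) * rlKer (p + σ + (i.1 + j.1 : ℕ)) u.1)
        * (y ^ (i.2 + j.2) * rlKer (q + τ + υ * (i.2 + j.2 : ℕ)) u.2) := by
  have pos : ∀ r : ℂ, 0 < r.re → ∀ n : ℕ, 0 < (r + n).re := by
    intro r hr n
    simp only [Complex.add_re, Complex.natCast_re]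
    positivity
  have pos' : ∀ r : ℂ, 0 < r.re → ∀ n : ℕ, 0 < (r + υ * n).re := by
    intro r hr n
    simp only [Complex.add_re, Complex.mul_re, Complex.natCast_re, Complex.natCast_im, mul_zero,
      sub_zero]
    positivity
  have e : ∀ s : ℝ × ℝ, kerTerm a b p q υ x y i s * kerTerm a' b' σ τ υ x y j (u - s)
      = serCoeff a b i.1 i.2 * serCoeff a' b' j.1 j.2 * x ^ (i.1 + j.1) * y ^ (i.2 + j.2)
        * (rlKer₂ (p + i.1) (q + υ * i.2) s * rlKer₂ (σ + j.1) (τ + υ * j.2) (u - s)) := by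
    intro s
    simp only [kerTerm, rlKer₂, pow_add]
    ring
  simp only [e]
  rw [integral_const_mul, integral_rlKer₂_mul_rlKer₂ (pos p hp _) (pos' q hq _) (pos σ hσ _)
    (pos' τ hτ _) h1 h2, rlKer₂]
  rw [show p + (i.1 : ℂ) + (σ + j.1) = p + σ + (i.1 + j.1 : ℕ) by push_cast; ring,
    show q + υ * (i.2 : ℂ) + (τ + υ * j.2) = q + τ + υ * (i.2 + j.2 : ℕ) by push_cast; ring]
  ring

/-- Integrated term by term, each product depends on the indices only through their sums, apart from
the coefficients; the cancellation of the two series then leaves the term of index 0. -/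
lemma integral_mlKer_mul_mlKer_neg {p q σ τ υ : ℂ} (hp : 0 < p.re) (hq : 0 < q.re)
    (hσ : 0 < σ.re) (hτ : 0 < τ.re) (hυ : 0 < υ.re) (a b x y : ℂ) {u : ℝ × ℝ}
    (h1 : 0 < u.1) (h2 : 0 < u.2) :
    ∫ s in Set.Ioo 0 u.1 ×ˢ Set.Ioo 0 u.2,
      mlKer a b p q υ x y s * mlKer (-a) (-b) σ τ υ x y (u - s) = rlKer₂ (p + σ) (q + τ) u := by
  set B := Set.Ioo 0 u.1 ×ˢ Set.Ioo 0 u.2 with hB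
  have hmeas : MeasurableSet B := measurableSet_Ioo.prod measurableSet_Ioo
  have hmem : ∀ s ∈ B, u - s ∈ B := by
    rintro s ⟨⟨a1, a2⟩, a3, a4⟩
    refine ⟨⟨?_, ?_⟩, ?_, ?_⟩ <;> simp only [Prod.fst_sub, Prod.snd_sub] <;> linarith
  set M := kerBound a b p q υ x y u.1 u.2 with hM
  set M' := kerBound (-a) (-b) σ τ υ x y u.1 u.2 with hM'
  have sM : Summable M := summable_kerBound hυ a b p q x y h1.le h2.le
  have sM' : Summable M' := summable_kerBound hυ (-a) (-b) σ τ x y h1.le h2.le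
  have nM : ∀ i, 0 ≤ M i := kerBound_nonneg a b p q υ x y h1.le h2.le
  have nM' : ∀ i, 0 ≤ M' i := kerBound_nonneg (-a) (-b) σ τ υ x y h1.le h2.le
  have sMM := sM.mul_of_nonneg sM' nM nM'
  set g : ℝ × ℝ → ℝ := fun s => (s.1 ^ (p.re - 1) * s.2 ^ (q.re - 1))
    * ((u - s).1 ^ (σ.re - 1) * (u - s).2 ^ (τ.re - 1)) with hg
  -- Up to Gamma factors `g` is the norm of a product of Riemann–Liouville kernels, whose
  -- integrability is known.
  have hgi : IntegrableOn g B := by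
    refine ((integrableOn_rlKer₂_mul_rlKer₂ hp hq hσ hτ h1 h2).norm.const_mul
      (‖Complex.Gamma p‖ * ‖Complex.Gamma q‖ * ‖Complex.Gamma σ‖ * ‖Complex.Gamma τ‖)).congr ?_
    filter_upwards [ae_restrict_mem hmeas] with s hs
    have hs' := hmem s hs
    have n1 := norm_ne_zero_iff.2 (Gamma_ne_zero hp)
    have n2 := norm_ne_zero_iff.2 (Gamma_ne_zero hq)
    have n3 := norm_ne_zero_iff.2 (Gamma_ne_zero hσ)
    have n4 := norm_ne_zero_iff.2 (Gamma_ne_zero hτ)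
    simp only [rlKer₂, norm_mul, norm_rlKer hs.1.1, norm_rlKer hs.2.1, norm_rlKer hs'.1.1,
      norm_rlKer hs'.2.1, hg]
    field_simp
  have key := hasSum_integral_of_dominated_convergence (μ := volume.restrict B)
    (F := fun (i : (ℕ × ℕ) × (ℕ × ℕ)) s =>
      kerTerm a b p q υ x y i.1 s * kerTerm (-a) (-b) σ τ υ x y i.2 (u - s))
    (f := fun s => mlKer a b p q υ x y s * mlKer (-a) (-b) σ τ υ x y (u - s))
    (fun i s => M i.1 * M' i.2 * g s) (fun i => ?_) (fun i => ?_) ?_ ?_ ?_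
  · rw [← key.tsum_eq]
    have hs := key.summable
    simp only [hB, integral_kerTerm_mul_kerTerm hp hq hσ hτ hυ a b (-a) (-b) x y h1 h2] at hs ⊢
    have := tsum_serCoeff_mul_serCoeff_neg a b (fun n => x ^ n * rlKer (p + σ + (n : ℕ)) u.1)
      (fun n => y ^ n * rlKer (q + τ + υ * (n : ℕ)) u.2) hs
    rw [this, rlKer₂]
    simp
  · exact ((measurable_kerTerm _ _ _ _ _ _ _ _).mul ((measurable_kerTerm _ _ _ _ _ _ _ _).comp
      (measurable_const.sub measurable_id))).aestronglyMeasurable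
  · filter_upwards [ae_restrict_mem hmeas] with s hs
    have b1 := norm_kerTerm_le hυ a b p q x y hs i.1
    have b2 := norm_kerTerm_le hυ (-a) (-b) σ τ x y (hmem s hs) i.2
    rw [norm_mul]
    refine (mul_le_mul b1 b2 (norm_nonneg _) ((norm_nonneg _).trans b1)).trans_eq ?_
    simp only [hg, hM, hM']
    ring
  · exact Eventually.of_forall fun s => sMM.mul_right _
  · simp only [tsum_mul_right]
    exact hgi.const_mul _
  · filter_upwards [ae_restrict_mem hmeas] with s hs
    have hs' := hmem s hs
    have c1 := summable_norm_kerTerm hυ a b p q x y hs.1.1 hs.2.1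
    have c2 := summable_norm_kerTerm hυ (-a) (-b) σ τ x y hs'.1.1 hs'.2.1
    rw [mlKer, mlKer, tsum_mul_tsum_of_summable_norm c1 c2]
    exact (summable_mul_of_summable_norm c1 c2).hasSum

/-! ### Volterra convolution operators on a rectangle -/

/-- The integral operator with the causal difference kernel `K` and base point `a`. -/
def volterra (K d : ℝ × ℝ → ℂ) (a x : ℝ × ℝ) : ℂ :=
  ∫ s in Set.Ioo a.1 x.1 ×ˢ Set.Ioo a.2 x.2, K (x - s) * d s

/-- The open rectangle with corners `a`, `b`. -/
def rect (a b : ℝ × ℝ) : Set (ℝ × ℝ) := Set.Ioo a.1 b.1 ×ˢ Set.Ioo a.2 b.2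

lemma measurableSet_rect (a b : ℝ × ℝ) : MeasurableSet (rect a b) :=
  measurableSet_Ioo.prod measurableSet_Ioo

lemma isOpen_rect (a b : ℝ × ℝ) : IsOpen (rect a b) := isOpen_Ioo.prod isOpen_Ioo

lemma mem_rect {a b x : ℝ × ℝ} :
    x ∈ rect a b ↔ (a.1 < x.1 ∧ x.1 < b.1) ∧ a.2 < x.2 ∧ x.2 < b.2 := Iff.rfl

open ContinuousLinearMap in
-- Truncating both functions turns the Volterra integral into a convolution on the whole plane: the
-- lower constraints cut out `rect a x`, and the upper ones hold automatically for `x` in the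
-- rectangle.
lemma indicator_mul_indicator_sub {𝕜 : Type*} [RCLike 𝕜] (K d : ℝ × ℝ → 𝕜) {a b x : ℝ × ℝ}
    (hx : x ∈ rect a b) (s : ℝ × ℝ) :
    mul 𝕜 𝕜 ((rect a b).indicator d s) ((rect 0 (b - a)).indicator K (x - s))
      = (rect a x).indicator (fun s => K (x - s) * d s) s := by
  classical
  rw [mul_apply', Set.indicator_apply, Set.indicator_apply, Set.indicator_apply]
  simp only [mem_rect, Prod.fst_sub, Prod.snd_sub, Prod.fst_zero, Prod.snd_zero] at hx ⊢
  obtain ⟨⟨h1, h2⟩, h3, h4⟩ := hx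
  by_cases h : (a.1 < s.1 ∧ s.1 < x.1) ∧ a.2 < s.2 ∧ s.2 < x.2
  · rw [if_pos h, if_pos (by obtain ⟨⟨_, _⟩, _, _⟩ := h; refine ⟨⟨?_, ?_⟩, ?_, ?_⟩ <;> linarith),
      if_pos (by obtain ⟨⟨_, _⟩, _, _⟩ := h; refine ⟨⟨?_, ?_⟩, ?_, ?_⟩ <;> linarith), mul_comm]
  · rw [if_neg h]
    by_cases h' : (a.1 < s.1 ∧ s.1 < b.1) ∧ a.2 < s.2 ∧ s.2 < b.2
    · rw [if_neg (c := (0 < x.1 - s.1 ∧ _) ∧ _), mul_zero]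
      rintro ⟨⟨_, _⟩, _, _⟩
      obtain ⟨⟨_, _⟩, _, _⟩ := h'
      exact h ⟨⟨by assumption, by linarith⟩, by assumption, by linarith⟩
    · rw [if_neg h', zero_mul]

section Convolution

open ContinuousLinearMap
open scoped Convolution

variable {K L d : ℝ × ℝ → ℂ} {a b x : ℝ × ℝ}

lemma convolutionExistsAt_indicator_iff {𝕜 : Type*} [RCLike 𝕜] {K d : ℝ × ℝ → 𝕜}
    (hx : x ∈ rect a b) :
    ConvolutionExistsAt ((rect a b).indicator d) ((rect 0 (b - a)).indicator K) x (mul 𝕜 𝕜)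
      ↔ IntegrableOn (fun s => K (x - s) * d s) (rect a x) := by
  rw [ConvolutionExistsAt, funext (indicator_mul_indicator_sub K d hx),
    integrable_indicator_iff (measurableSet_rect _ _)]

lemma convolution_indicator_eq {𝕜 : Type*} [RCLike 𝕜] {K d : ℝ × ℝ → 𝕜} (hx : x ∈ rect a b) :
    ((rect a b).indicator d ⋆[mul 𝕜 𝕜] (rect 0 (b - a)).indicator K) x
      = ∫ s in rect a x, K (x - s) * d s := by
  rw [convolution_def, funext (indicator_mul_indicator_sub K d hx),
    integral_indicator (measurableSet_rect _ _)]

lemma volterra_defined (hK : IntegrableOn K (rect 0 (b - a))) (hd : IntegrableOn d (rect a b)) :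
    (∀ᵐ x ∂(volume.restrict (rect a b)), IntegrableOn (fun s => K (x - s) * d s) (rect a x)) ∧
      IntegrableOn (volterra K d a) (rect a b) := by
  have hK' := (integrable_indicator_iff (measurableSet_rect _ _)).2 hK
  have hd' := (integrable_indicator_iff (measurableSet_rect _ _)).2 hd
  constructor
  · rw [ae_restrict_iff' (measurableSet_rect _ _)]
    filter_upwards [hd'.ae_convolution_exists (mul ℂ ℂ) hK'] with x h hx
    exact (convolutionExistsAt_indicator_iff hx).1 h
  · refine ((hd'.integrable_convolution (mul ℂ ℂ) hK').integrableOn (s := rect a b)).congr_fun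
      (fun x hx => ?_) (measurableSet_rect _ _)
    exact convolution_indicator_eq hx

/-- The convolution of truncated kernels vanishes off the positive quadrant. -/
lemma convolution_truncated_eq_zero {𝕜 : Type*} [RCLike 𝕜] {K L : ℝ × ℝ → 𝕜} {c u : ℝ × ℝ}
    (hu : ¬ (0 < u.1 ∧ 0 < u.2)) :
    ((rect 0 c).indicator K ⋆[mul 𝕜 𝕜] (rect 0 c).indicator L) u = 0 := by
  rw [convolution_def, ← integral_zero (ℝ × ℝ) 𝕜]
  congr 1
  funext s
  classical
  rw [mul_apply', Set.indicator_apply, Set.indicator_apply]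
  simp only [mem_rect, Prod.fst_sub, Prod.snd_sub, Prod.fst_zero, Prod.snd_zero]
  split_ifs with h1 h2
  · exact absurd ⟨by linarith [h1.1.1, h2.1.1], by linarith [h1.2.1, h2.2.1]⟩ hu
  all_goals simp

lemma convolution_truncated_eq {𝕜 : Type*} [RCLike 𝕜] {K L : ℝ × ℝ → 𝕜} {c u : ℝ × ℝ}
    (hu : u ∈ rect 0 c) :
    ((rect 0 c).indicator K ⋆[mul 𝕜 𝕜] (rect 0 c).indicator L) u
      = ∫ s in rect 0 u, K s * L (u - s) := by
  have := convolution_indicator_eq (K := L) (d := K) hu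
  rw [sub_zero] at this
  simp only [this, mul_comm]

/-- Associativity at a point: the composition of two Volterra operators. -/
lemma volterra_comp {M φ : ℝ × ℝ → ℂ} (hK : IntegrableOn K (rect 0 (b - a)))
    (hL : IntegrableOn L (rect 0 (b - a))) (hd : IntegrableOn d (rect a b))
    (hM : ∀ u ∈ rect 0 (b - a), ∫ s in rect 0 u, K s * L (u - s) = M u)
    (hφ : φ =ᵐ[volume.restrict (rect a b)] volterra K d a) (hx : x ∈ rect a b)
    (hex : ConvolutionExistsAt (fun s => ‖(rect a b).indicator d s‖)
      ((fun s => ‖(rect 0 (b - a)).indicator K s‖) ⋆[mul ℝ ℝ]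
        fun s => ‖(rect 0 (b - a)).indicator L s‖) x (mul ℝ ℝ)) :
    IntegrableOn (fun s => L (x - s) * φ s) (rect a x) ∧
      volterra L φ a x = volterra M d a x := by
  set Kt := (rect 0 (b - a)).indicator K with hKt
  set Lt := (rect 0 (b - a)).indicator L with hLt
  set dt := (rect a b).indicator d with hdt
  have hK' : Integrable Kt := (integrable_indicator_iff (measurableSet_rect _ _)).2 hK
  have hL' : Integrable Lt := (integrable_indicator_iff (measurableSet_rect _ _)).2 hL
  have hd' : Integrable dt := (integrable_indicator_iff (measurableSet_rect _ _)).2 hd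
  have hgk := hK'.norm.ae_convolution_exists (mul ℝ ℝ) hL'.norm
  have hsub : rect a x ⊆ rect a b := fun s hs =>
    ⟨⟨hs.1.1, hs.1.2.trans hx.1.2⟩, hs.2.1, hs.2.2.trans hx.2.2⟩
  have hφ' : φ =ᵐ[volume.restrict (rect a x)] dt ⋆[mul ℂ ℂ] Kt := by
    filter_upwards [ae_restrict_of_ae_restrict_of_subset hsub hφ,
      ae_restrict_mem (measurableSet_rect a x)] with s h hs
    exact h.trans (convolution_indicator_eq (hsub hs)).symm
  -- Outside `rect a b` the convolution need not vanish. But if $x-s$ lies in the support of the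
  -- truncated `L`, then $s<x<b$ in both coordinates, so some coordinate of $s$ is at most that of
  -- $a$, and there causality gives 0.
  have hpt : ∀ s, mul ℂ ℂ ((dt ⋆[mul ℂ ℂ] Kt) s) (Lt (x - s))
      = (rect a x).indicator (fun s => L (x - s) * (dt ⋆[mul ℂ ℂ] Kt) s) s := by
    intro s
    by_cases hs : s ∈ rect a b
    · rw [← indicator_mul_indicator_sub L _ hx s, Set.indicator_of_mem hs]
    · rw [Set.indicator_of_notMem fun h => hs (hsub h)]
      by_cases hs' : x - s ∈ rect 0 (b - a)
      · have : (dt ⋆[mul ℂ ℂ] Kt) s = 0 := by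
          rw [convolution_def, ← integral_zero (ℝ × ℝ) ℂ]
          congr 1
          funext r
          classical
          rw [mul_apply', hdt, hKt, Set.indicator_apply, Set.indicator_apply]
          simp only [mem_rect, Prod.fst_sub, Prod.snd_sub, Prod.fst_zero, Prod.snd_zero] at hs hs' hx ⊢
          split_ifs with h1 h2
          · refine absurd ⟨⟨?_, ?_⟩, ?_, ?_⟩ hs
            · linarith [h1.1.1, h2.1.1]
            · linarith [hs'.1.1, hx.1.2]
            · linarith [h1.2.1, h2.2.1]
            · linarith [hs'.2.1, hx.2.2]
          all_goals simp
        rw [this, map_zero, zero_apply]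
      · rw [hLt, Set.indicator_of_notMem hs', map_zero]
  constructor
  · have hint : Integrable (fun s => mul ℂ ℂ ((dt ⋆[mul ℂ ℂ] Kt) s) (Lt (x - s))) := by
      -- Fubini for $d(r)K(s-r)L(x-s)$: `hex` supplies absolute convergence of the double integral
      -- at this particular `x`, and integrating out `r` gives integrability in `s`.
      have hmeas : AEStronglyMeasurable
          (Function.uncurry fun s r => dt r * Kt (s - r) * Lt (x - s))
          ((volume : Measure (ℝ × ℝ)).prod (volume : Measure (ℝ × ℝ))) := by
        refine AEStronglyMeasurable.mul ?_ ?_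
        · exact hd'.aestronglyMeasurable.convolution_integrand (mul ℂ ℂ) hK'.aestronglyMeasurable
        · exact (hL'.aestronglyMeasurable.comp_quasiMeasurePreserving
            (quasiMeasurePreserving_sub_left_of_right_invariant volume x)).comp_fst
      have hslice : ∀ r : ℝ × ℝ, (fun s => dt r * Kt (s - r) * Lt (x - s))
          = fun s => dt r * (fun v => Kt v * Lt (x - r - v)) (s - r) := by
        intro r
        funext s
        simp only [sub_sub_sub_cancel_right]
        ring
      have hae := (quasiMeasurePreserving_sub_left_of_right_invariant
        (volume : Measure (ℝ × ℝ)) x).ae hgk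
      have hI : Integrable (Function.uncurry fun s r => dt r * Kt (s - r) * Lt (x - s))
          ((volume : Measure (ℝ × ℝ)).prod (volume : Measure (ℝ × ℝ))) := by
        rw [integrable_prod_iff' hmeas]
        constructor
        · filter_upwards [hae] with r hr
          have hr' : Integrable fun v => Kt v * Lt (x - r - v) :=
            hr.of_norm (mul ℂ ℂ) hK'.aestronglyMeasurable hL'.aestronglyMeasurable
          simp only [Function.uncurry]
          rw [hslice r]
          exact (hr'.comp_sub_right r).const_mul _
        · refine (ConvolutionExistsAt.integrable hex).congr (Eventually.of_forall fun r => ?_)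
          have : ∀ s, ‖dt r * Kt (s - r) * Lt (x - s)‖
              = ‖dt r‖ * (fun v => ‖Kt v‖ * ‖Lt (x - r - v)‖) (s - r) := by
            intro s
            rw [congrFun (hslice r) s]
            simp only [norm_mul]
          simp only [Function.uncurry, this, integral_const_mul]
          rw [integral_sub_right_eq_self (fun v => ‖Kt v‖ * ‖Lt (x - r - v)‖)]
          rfl
      refine hI.integral_prod_left.congr (Eventually.of_forall fun s => ?_)
      simp only [Function.uncurry, integral_mul_const]
      rfl
    rw [funext hpt, integrable_indicator_iff (measurableSet_rect _ _)] at hint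
    refine hint.congr ?_
    filter_upwards [hφ'] with s hs
    rw [hs]
  · have hassoc := convolution_assoc (mul ℂ ℂ) (mul ℂ ℂ) (mul ℂ ℂ) (mul ℂ ℂ)
      (fun p q r => by simp [mul_assoc]) hd'.aestronglyMeasurable hK'.aestronglyMeasurable
      hL'.aestronglyMeasurable (hd'.ae_convolution_exists (mul ℂ ℂ) hK') hgk hex
    have e1 : volterra L φ a x = ((dt ⋆[mul ℂ ℂ] Kt) ⋆[mul ℂ ℂ] Lt) x := by
      rw [convolution_def, funext hpt, integral_indicator (measurableSet_rect _ _), volterra]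
      refine integral_congr_ae ?_
      filter_upwards [hφ'] with s hs
      rw [hs]
    -- The convolution of the truncated kernels may differ from `M` beyond $b-a$, but $s,x$ in the
    -- rectangle force $x-s<b-a$.
    have e2 : volterra M d a x = (dt ⋆[mul ℂ ℂ] (Kt ⋆[mul ℂ ℂ] Lt)) x := by
      have := convolution_indicator_eq (K := M) (d := d) hx
      rw [volterra]
      refine this.symm.trans ?_
      rw [convolution_def, convolution_def]
      congr 1
      funext s
      by_cases hs : s ∈ rect a b
      · by_cases hs' : x - s ∈ rect 0 (b - a)
        · rw [Set.indicator_of_mem hs', ← hM _ hs', hKt, hLt, convolution_truncated_eq hs']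
        · rw [Set.indicator_of_notMem hs', hKt, hLt, convolution_truncated_eq_zero]
          rintro ⟨h1, h2⟩
          refine hs' ⟨⟨h1, ?_⟩, h2, ?_⟩
          · simp only [Prod.fst_sub]
            linarith [hs.1.1, hx.1.2]
          · simp only [Prod.snd_sub]
            linarith [hs.2.1, hx.2.2]
      · rw [hdt, Set.indicator_of_notMem hs]
        simp
    rw [e1, e2, hassoc]

lemma volterra_comp_ae {M φ : ℝ × ℝ → ℂ} (hK : IntegrableOn K (rect 0 (b - a)))
    (hL : IntegrableOn L (rect 0 (b - a))) (hd : IntegrableOn d (rect a b))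
    (hM : ∀ u ∈ rect 0 (b - a), ∫ s in rect 0 u, K s * L (u - s) = M u)
    (hφ : φ =ᵐ[volume.restrict (rect a b)] volterra K d a) :
    volterra L φ a =ᵐ[volume.restrict (rect a b)] volterra M d a := by
  have hK' := (integrable_indicator_iff (measurableSet_rect _ _)).2 hK
  have hL' := (integrable_indicator_iff (measurableSet_rect _ _)).2 hL
  have hd' := (integrable_indicator_iff (measurableSet_rect _ _)).2 hd
  rw [EventuallyEq, ae_restrict_iff' (measurableSet_rect _ _)]
  filter_upwards [hd'.norm.ae_convolution_exists (mul ℝ ℝ)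
    (hK'.norm.integrable_convolution (mul ℝ ℝ) hL'.norm)] with x hex hx
  exact (volterra_comp hK hL hd hM hφ hx hex).2

/-- A bounded kernel convolution paired with an integrable `d` converges at every point, so no null
set is lost; this is what allows differentiation afterwards. -/
lemma volterra_comp_of_bounded {M φ : ℝ × ℝ → ℂ} (hK : IntegrableOn K (rect 0 (b - a)))
    (hL : IntegrableOn L (rect 0 (b - a))) (hd : IntegrableOn d (rect a b))
    (hM : ∀ u ∈ rect 0 (b - a), ∫ s in rect 0 u, K s * L (u - s) = M u)
    (hφ : φ =ᵐ[volume.restrict (rect a b)] volterra K d a) {C : ℝ}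
    (hC : ∀ u ∈ rect 0 (b - a), ∫ s in rect 0 u, ‖K s‖ * ‖L (u - s)‖ ≤ C) (hx : x ∈ rect a b) :
    IntegrableOn (fun s => L (x - s) * φ s) (rect a x) ∧
      volterra L φ a x = volterra M d a x := by
  refine volterra_comp hK hL hd hM hφ hx ?_
  have hK' := (integrable_indicator_iff (measurableSet_rect _ _)).2 hK
  have hL' := (integrable_indicator_iff (measurableSet_rect _ _)).2 hL
  have hd' := (integrable_indicator_iff (measurableSet_rect _ _)).2 hd
  refine Integrable.mono' (hd'.norm.mul_const |C|) ?_ (Eventually.of_forall fun s => ?_)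
  · exact hd'.aestronglyMeasurable.norm.mul
      ((hK'.norm.integrable_convolution (mul ℝ ℝ)
        hL'.norm).aestronglyMeasurable.comp_quasiMeasurePreserving
          (quasiMeasurePreserving_sub_left_of_right_invariant volume x))
  · by_cases hs : s ∈ rect a b
    · rw [mul_apply', norm_mul, norm_norm]
      refine mul_le_mul_of_nonneg_left ?_ (norm_nonneg _)
      simp only [norm_indicator_eq_indicator_norm]
      by_cases hs' : x - s ∈ rect 0 (b - a)
      · rw [convolution_truncated_eq hs', Real.norm_of_nonneg
          (integral_nonneg fun _ => by positivity)]
        exact (hC _ hs').trans (le_abs_self C)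
      · rw [convolution_truncated_eq_zero]
        · simp
        rintro ⟨h1, h2⟩
        refine hs' ⟨⟨h1, ?_⟩, h2, ?_⟩
        · simp only [Prod.fst_sub]
          linarith [hs.1.1, hx.1.2]
        · simp only [Prod.snd_sub]
          linarith [hs.2.1, hx.2.2]
    · simp [hs]

end Convolution

/-! ### Iterated integrals in one variable -/

/-- The `n`-fold iterated integral with base point `a`. -/
def iterInt (a : ℝ) : ℕ → (ℝ → ℂ) → ℝ → ℂ
  | 0, h => h
  | n + 1, h => fun z => ∫ ξ in a..z, iterInt a n h ξ

lemma continuous_iterInt_succ {h : ℝ → ℂ} (hh : Integrable h) (a : ℝ) (n : ℕ) :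
    Continuous (iterInt a (n + 1) h) := by
  induction n with
  | zero => exact intervalIntegral.continuous_primitive (fun _ _ => hh.intervalIntegrable) a
  | succ n ih =>
    exact intervalIntegral.continuous_primitive (fun _ _ => ih.intervalIntegrable _ _) a

/-- From the second integration on the integrand is continuous, so the fundamental theorem holds
everywhere. -/
lemma hasDerivAt_iterInt {h : ℝ → ℂ} (hh : Integrable h) (a : ℝ) (n : ℕ) (z : ℝ) :
    HasDerivAt (iterInt a (n + 2) h) (iterInt a (n + 1) h z) z :=
  intervalIntegral.integral_hasDerivAt_right
    ((continuous_iterInt_succ hh a n).intervalIntegrable _ _)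
    ((continuous_iterInt_succ hh a n).stronglyMeasurableAtFilter _ _)
    (continuous_iterInt_succ hh a n).continuousAt

lemma iteratedDeriv_iterInt {h : ℝ → ℂ} (hh : Integrable h) (a : ℝ) (n k : ℕ) :
    iteratedDeriv k (iterInt a (n + k + 1) h) = iterInt a (n + 1) h := by
  induction k with
  | zero => simp
  | succ k ih =>
    rw [iteratedDeriv_succ', ← ih]
    congr 1
    exact funext fun z => (hasDerivAt_iterInt hh a (n + k) z).deriv

/-- Only the innermost primitive, of the merely integrable `h`, can fail to be differentiable; `hx`
settles it at `x`. -/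
lemma iterDifferentiableAt_iterInt {h : ℝ → ℂ} (hh : Integrable h) {a x : ℝ} {c : ℂ}
    (hx : HasDerivAt (fun z => ∫ ξ in a..z, h ξ) c x) (n : ℕ) :
    IterDifferentiableAt (n + 1) (iterInt a (n + 1) h) x ∧
      iteratedDeriv (n + 1) (iterInt a (n + 1) h) x = c := by
  have hn := iteratedDeriv_iterInt hh a 0 n
  rw [zero_add] at hn
  refine ⟨⟨fun k hk => ?_, fun k hk => ?_⟩, ?_⟩
  · obtain ⟨m, rfl⟩ : ∃ m, n = m + 1 + k := ⟨n - k - 1, by omega⟩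
    rw [iteratedDeriv_iterInt hh a (m + 1) k]
    exact Eventually.of_forall fun y => (hasDerivAt_iterInt hh a m y).differentiableAt
  · obtain rfl : k = n := by omega
    rw [hn]
    exact hx.differentiableAt
  · rw [iteratedDeriv_succ, hn]
    exact hx.deriv

lemma IterDifferentiableAt.congr {n : ℕ} {f g : ℝ → ℂ} {x : ℝ} (hf : IterDifferentiableAt n f x)
    (h : f =ᶠ[𝓝 x] g) : IterDifferentiableAt n g x := by
  have hk : ∀ k, iteratedDeriv k f =ᶠ[𝓝 x] iteratedDeriv k g := fun k => h.iteratedDeriv k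
  refine ⟨fun k hkn => ?_, fun k hkn => (hk k).differentiableAt_iff.1 (hf.2 k hkn)⟩
  filter_upwards [hf.1 k hkn, (hk k).eventuallyEq_nhds] with y hy hy'
  exact hy'.differentiableAt_iff.1 hy

/-- Cauchy's formula for repeated integration. -/
lemma iterInt_eq_setIntegral {h : ℝ → ℂ} (hh : Integrable h) (a : ℝ) (n : ℕ) {z : ℝ} (hz : a ≤ z) :
    ∫ ξ in Set.Ioo a z, ((z - ξ : ℝ) : ℂ) ^ n / n.factorial * h ξ = iterInt a (n + 1) h z := by
  induction n generalizing z with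
  | zero => simp [iterInt, intervalIntegral.integral_of_le hz, integral_Ioc_eq_integral_Ioo]
  | succ n ih =>
    change _ = ∫ ξ in a..z, iterInt a (n + 1) h ξ
    rw [intervalIntegral.integral_of_le hz, integral_Ioc_eq_integral_Ioo]
    -- Extending the kernel by 0 turns the triangle $\xi<s$ into a square, on which Fubini applies.
    set k : ℝ → ℝ → ℂ := fun s ξ =>
      (Set.Ioi (0 : ℝ)).indicator (fun v : ℝ => (v : ℂ) ^ n / n.factorial) (s - ξ) with hk
    have h1 : ∀ s ∈ Set.Ioo a z, iterInt a (n + 1) h s = ∫ ξ in Set.Ioo a z, k s ξ * h ξ := by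
      intro s hs
      rw [← ih hs.1.le]
      have : ∀ ξ, k s ξ * h ξ
          = (Set.Iio s).indicator (fun ξ => ((s - ξ : ℝ) : ℂ) ^ n / n.factorial * h ξ) ξ := by
        intro ξ
        by_cases hξ : ξ < s
        · rw [hk, Set.indicator_of_mem (show ξ ∈ Set.Iio s from hξ)]
          simp only
          rw [Set.indicator_of_mem (show s - ξ ∈ Set.Ioi 0 from sub_pos.2 hξ)]
        · rw [hk, Set.indicator_of_notMem (show ξ ∉ Set.Iio s from hξ)]
          simp only
          rw [Set.indicator_of_notMem (show s - ξ ∉ Set.Ioi 0 from fun h => hξ (sub_pos.1 h)),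
            zero_mul]
      simp only [this]
      rw [setIntegral_indicator measurableSet_Iio]
      congr 2
      ext ξ
      simp only [Set.mem_Ioo, Set.mem_inter_iff, Set.mem_Iio]
      exact ⟨fun h => ⟨⟨h.1, h.2.trans hs.2⟩, h.2⟩, fun h => ⟨h.1.1, h.2⟩⟩
    rw [setIntegral_congr_fun measurableSet_Ioo h1]
    have hkm : Measurable (Function.uncurry k) :=
      (Measurable.indicator (by fun_prop) measurableSet_Ioi).comp
        (measurable_fst.sub measurable_snd)
    have hint : Integrable (Function.uncurry fun s ξ => k s ξ * h ξ)
        ((volume.restrict (Set.Ioo a z)).prod (volume.restrict (Set.Ioo a z))) := by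
      have hc : Integrable (fun _ : ℝ => (1 : ℂ)) (volume.restrict (Set.Ioo a z)) :=
        integrable_const _
      have := hc.mul_prod (hh.restrict (s := Set.Ioo a z))
      simp only [one_mul] at this
      refine Integrable.bdd_mul (c := (z - a) ^ n / n.factorial) this
        hkm.aestronglyMeasurable ?_
      rw [Measure.prod_restrict]
      filter_upwards [ae_restrict_mem (measurableSet_Ioo.prod measurableSet_Ioo)] with p hp
      obtain ⟨⟨a1, a2⟩, a3, a4⟩ := hp
      simp only [hk]
      by_cases hp' : 0 < p.1 - p.2
      · rw [Set.indicator_of_mem (show p.1 - p.2 ∈ Set.Ioi 0 from hp'), norm_div, norm_pow,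
          Complex.norm_natCast, Complex.norm_real, Real.norm_of_nonneg hp'.le]
        have : p.1 - p.2 ≤ z - a := by linarith
        gcongr
      · rw [Set.indicator_of_notMem (show p.1 - p.2 ∉ Set.Ioi 0 from hp'), norm_zero]
        have : 0 ≤ z - a := by linarith
        positivity
    rw [integral_integral_swap hint]
    refine setIntegral_congr_fun measurableSet_Ioo fun ξ hξ => ?_
    simp only [integral_mul_const]
    congr 1
    have : ∀ s, k s ξ = (Set.Ioi ξ).indicator (fun s => ((s - ξ : ℝ) : ℂ) ^ n / n.factorial) s := by
      intro s
      by_cases hs : ξ < s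
      · rw [hk, Set.indicator_of_mem (show s ∈ Set.Ioi ξ from hs)]
        simp only
        rw [Set.indicator_of_mem (show s - ξ ∈ Set.Ioi 0 from sub_pos.2 hs)]
      · rw [hk, Set.indicator_of_notMem (show s ∉ Set.Ioi ξ from hs)]
        simp only
        rw [Set.indicator_of_notMem (show s - ξ ∉ Set.Ioi 0 from fun h => hs (sub_pos.1 h))]
    simp only [this]
    rw [setIntegral_indicator measurableSet_Ioi, show Set.Ioo a z ∩ Set.Ioi ξ = Set.Ioo ξ z by
      ext s
      simp only [Set.mem_Ioo, Set.mem_inter_iff, Set.mem_Ioi]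
      exact ⟨fun h => ⟨h.2, h.1.2⟩, fun h => ⟨⟨hξ.1.trans h.1, h.2⟩, h.1⟩⟩,
      ← integral_Ioc_eq_integral_Ioo, ← intervalIntegral.integral_of_le hξ.2.le,
      intervalIntegral.integral_comp_sub_right (fun v : ℝ => (v : ℂ) ^ n / n.factorial),
      intervalIntegral.integral_div, sub_self]
    have hpow : ∫ v in (0 : ℝ)..(z - ξ), (v : ℂ) ^ n = ((z - ξ : ℝ) : ℂ) ^ (n + 1) / (n + 1) := by
      have := congrArg (Complex.ofReal) (integral_pow (a := 0) (b := z - ξ) n)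
      rw [← intervalIntegral.integral_ofReal] at this
      push_cast at this ⊢
      simpa using this
    rw [hpow, Nat.factorial_succ]
    push_cast
    rw [div_div]

/-! ### Lebesgue points of `L¹`-valued functions -/

/-- The exceptional null set must not depend on ψ, since ψ will range over the uncountable family
`powKer a r t`. Differentiate instead the countably many functions $N_k(\xi)=\|d(\xi,\cdot)-g_k\|_1$
with $g_k$ dense in $L^1$. At a good $z$ choose $g_k$ close to $d(z,\cdot)$; the pairing with any ψ
bounded by `C` then varies by at most $C(N_k(\xi)+N_k(z))$. -/
lemma ae_hasDerivAt_integral_slices {d : ℝ × ℝ → ℂ} (hd : Integrable d) :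
    ∀ᵐ z : ℝ, ∀ (ψ : ℝ → ℂ) (C : ℝ), Measurable ψ → (∀ y, ‖ψ y‖ ≤ C) → ∀ a : ℝ,
      HasDerivAt (fun z' => ∫ ξ in a..z', ∫ y, ψ y * d (ξ, y)) (∫ y, ψ y * d (z, y)) z := by
  have : Fact ((1 : ENNReal) ≠ ⊤) := ⟨ENNReal.one_ne_top⟩
  rw [Measure.volume_eq_prod] at hd
  let g : ℕ → Lp ℂ 1 (volume : Measure ℝ) := TopologicalSpace.denseSeq _
  let N : ℕ → ℝ → ℝ := fun k ξ => ∫ y, ‖d (ξ, y) - g k y‖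
  have hgi : ∀ k, Integrable (g k : ℝ → ℂ) := fun k => L1.integrable_coeFn _
  have hslice : ∀ᵐ ξ : ℝ, Integrable fun y => d (ξ, y) := hd.prod_right_ae
  have hN : ∀ k, LocallyIntegrable (N k) := by
    intro k
    have hbd : LocallyIntegrable fun ξ => (∫ y, ‖d (ξ, y)‖) + ∫ y, ‖g k y‖ :=
      hd.norm.integral_prod_left.locallyIntegrable.add (locallyIntegrable_const _)
    refine hbd.mono ?_ ?_
    · exact (hd.aestronglyMeasurable.sub
        (hgi k).aestronglyMeasurable.comp_snd).norm.integral_prod_right'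
    · filter_upwards [hslice] with ξ hξ
      rw [Real.norm_of_nonneg (integral_nonneg fun _ => norm_nonneg _), Real.norm_of_nonneg
        (add_nonneg (integral_nonneg fun _ => norm_nonneg _)
          (integral_nonneg fun _ => norm_nonneg _)), ← integral_add hξ.norm (hgi k).norm]
      exact integral_mono (hξ.sub (hgi k)).norm (hξ.norm.add (hgi k).norm)
        fun y => norm_sub_le _ _
  have hae : ∀ᵐ z : ℝ, ∀ k, ∀ c, HasDerivAt (fun x => ∫ t in c..x, N k t) (N k z) z :=
    ae_all_iff.2 fun k => LocallyIntegrable.ae_hasDerivAt_integral (hN k)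
  filter_upwards [hslice, hae] with z hz hzN ψ C hψ hC a
  have hC0 : 0 ≤ C := (norm_nonneg _).trans (hC 0)
  set φ : ℝ → ℂ := fun ξ => ∫ y, ψ y * d (ξ, y) with hφ
  have hφi : Integrable φ := by
    have : Integrable (fun p : ℝ × ℝ => ψ p.2 * d p) (volume.prod volume) :=
      hd.bdd_mul (c := C) (hψ.comp measurable_snd).aestronglyMeasurable
        (Eventually.of_forall fun p => hC _)
    exact this.integral_prod_left
  have hψi : ∀ {f : ℝ → ℂ}, Integrable f → Integrable fun y => ψ y * f y := fun hf =>
    hf.bdd_mul (c := C) hψ.aestronglyMeasurable (Eventually.of_forall hC)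
  have hle : ∀ k, ∀ᵐ ξ : ℝ, ‖φ ξ - φ z‖ ≤ C * (N k ξ + N k z) := by
    intro k
    filter_upwards [hslice] with ξ hξ
    rw [hφ]
    simp only
    rw [← integral_sub (hψi hξ) (hψi hz)]
    simp only [N]
    have hadd := integral_add (hξ.sub (hgi k)).norm (hz.sub (hgi k)).norm
    simp only [Pi.sub_apply] at hadd
    rw [← hadd, ← integral_const_mul]
    refine norm_integral_le_of_norm_le
      (((hξ.sub (hgi k)).norm.add (hz.sub (hgi k)).norm).const_mul C)
      (Eventually.of_forall fun y => ?_)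
    rw [← mul_sub, norm_mul]
    refine mul_le_mul (hC y) ?_ (norm_nonneg _) hC0
    rw [show d (ξ, y) - d (z, y) = (d (ξ, y) - g k y) - (d (z, y) - g k y) by ring]
    exact norm_sub_le _ _
  rw [hasDerivAt_iff_isLittleO, Asymptotics.isLittleO_iff]
  intro ε hε
  -- The mean of $N_k$ near $z$ is within δ of $N_k(z)$, and $2N_k(z)<2\delta$, for a total of 3δ;
  -- `C + 1` avoids division by 0.
  set δ := ε / (3 * (C + 1)) with hδ
  have hδ0 : 0 < δ := by positivity
  obtain ⟨k, hk⟩ : ∃ k, N k z < δ := by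
    obtain ⟨k, hk⟩ := (TopologicalSpace.denseRange_denseSeq (Lp ℂ 1 (volume : Measure ℝ))).exists_dist_lt
      (hz.toL1 _) hδ0
    refine ⟨k, lt_of_eq_of_lt ?_ hk⟩
    rw [dist_eq_norm, L1.norm_eq_integral_norm]
    refine integral_congr_ae ?_
    filter_upwards [hz.coeFn_toL1, Lp.coeFn_sub (hz.toL1 _) (g k)] with y h1 h2
    rw [h2, Pi.sub_apply, h1]
  have hNd := hzN k z
  rw [hasDerivAt_iff_isLittleO, Asymptotics.isLittleO_iff] at hNd
  filter_upwards [hNd hδ0] with x' hx'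
  have hNint : ∀ u v : ℝ, IntervalIntegrable (N k) volume u v := fun u v =>
    intervalIntegrable_iff.2 (((hN k).integrableOn_isCompact isCompact_uIcc).mono_set
      Set.uIoc_subset_uIcc)
  have e1 : (∫ ξ in a..x', φ ξ) - (∫ ξ in a..z, φ ξ) - (x' - z) • φ z
      = ∫ ξ in z..x', (φ ξ - φ z) := by
    rw [intervalIntegral.integral_interval_sub_left hφi.intervalIntegrable hφi.intervalIntegrable,
      intervalIntegral.integral_sub hφi.intervalIntegrable intervalIntegrable_const,
      intervalIntegral.integral_const]
  rw [e1]
  have e2 : ∫ ξ in z..x', C * (N k ξ + N k z)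
      = C * ((∫ ξ in z..x', N k ξ) + (x' - z) * N k z) := by
    rw [intervalIntegral.integral_const_mul, intervalIntegral.integral_add (hNint _ _)
      intervalIntegrable_const, intervalIntegral.integral_const, smul_eq_mul]
  have e3 := intervalIntegral.norm_integral_le_abs_of_norm_le (a := z) (b := x')
    (ae_restrict_of_ae (hle k))
    (((hNint z x').add (intervalIntegrable_const (c := N k z))).const_mul C)
  refine e3.trans ?_
  rw [e2, abs_mul, abs_of_nonneg hC0]
  simp only [intervalIntegral.integral_same, sub_zero, smul_eq_mul, Real.norm_eq_abs] at hx' ⊢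
  have hNk : 0 ≤ N k z := integral_nonneg fun _ => norm_nonneg _
  have h3 : |(∫ ξ in z..x', N k ξ) + (x' - z) * N k z| ≤ 3 * δ * |x' - z| := by
    have : (∫ ξ in z..x', N k ξ) + (x' - z) * N k z
        = ((∫ ξ in z..x', N k ξ) - (x' - z) * N k z) + 2 * N k z * (x' - z) := by ring
    rw [this]
    refine (abs_add_le _ _).trans ?_
    rw [abs_mul, abs_of_nonneg (by positivity : 0 ≤ 2 * N k z)]
    nlinarith [abs_nonneg (x' - z)]
  refine (mul_le_mul_of_nonneg_left h3 hC0).trans ?_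
  have : C * (3 * δ) ≤ ε := by
    rw [hδ, mul_div_mul_left _ _ (by norm_num : (3 : ℝ) ≠ 0) |> fun h =>
      show (3 : ℝ) * (ε / (3 * (C + 1))) = ε / (C + 1) by rw [← mul_div_assoc, h],
      ← mul_div_assoc, div_le_iff₀ (by positivity)]
    nlinarith
  calc C * (3 * δ * |x' - z|) = C * (3 * δ) * |x' - z| := by ring
    _ ≤ _ := mul_le_mul_of_nonneg_right this (abs_nonneg _)

/-! ### Differentiation of slices -/

/-- By density and continuity off 0, difference quotients need only be tested at rational
increments, which makes the set of differentiability points measurable. -/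
lemma tendsto_nhdsNE_of_tendsto_rat {g : ℝ → ℂ} {L : ℂ} (hg : ContinuousOn g {0}ᶜ)
    (h : Tendsto (fun r : ℚ => g r) (comap (fun r : ℚ => (r : ℝ)) (𝓝[≠] 0)) (𝓝 L)) :
    Tendsto g (𝓝[≠] 0) (𝓝 L) := by
  rw [Metric.nhds_basis_closedBall.tendsto_right_iff]
  intro ε hε
  have h' := h.eventually (Metric.closedBall_mem_nhds L hε)
  rw [eventually_comap, eventually_nhdsWithin_iff, Metric.eventually_nhds_iff_ball] at h'
  obtain ⟨δ, hδ, hball⟩ := h'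
  rw [eventually_nhdsWithin_iff, Metric.eventually_nhds_iff_ball]
  refine ⟨δ, hδ, fun x hx hx0 => ?_⟩
  have hU : IsOpen (Metric.ball (0 : ℝ) δ ∩ {0}ᶜ) := Metric.isOpen_ball.inter isOpen_compl_singleton
  have hcl := (Rat.denseRange_cast (𝕜 := ℝ)).open_subset_closure_inter hU ⟨hx, hx0⟩
  have hcont : ContinuousWithinAt g (Metric.ball (0 : ℝ) δ ∩ {0}ᶜ ∩ Set.range ((↑) : ℚ → ℝ)) x :=
    (hg x hx0).mono fun y hy => hy.1.2
  have := hcont.mem_closure_image hcl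
  refine (Metric.isClosed_closedBall.closure_subset_iff.2 ?_) this
  rintro _ ⟨y, ⟨⟨hy1, hy2⟩, r, rfl⟩, rfl⟩
  exact hball _ hy1 hy2 r rfl

/-- Lebesgue differentiation on almost every slice gives a planar null set once the good set `S` is
known to be measurable. -/
lemma ae_hasDerivAt_integral_snd_of_stronglyMeasurable {d : ℝ × ℝ → ℂ} (hd : Integrable d)
    (hm : StronglyMeasurable d) :
    ∀ᵐ x : ℝ × ℝ, ∀ a : ℝ, HasDerivAt (fun t => ∫ y in a..t, d (x.1, y)) (d x) x.2 := by
  rw [Measure.volume_eq_prod] at hd ⊢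
  -- The primitive from −∞ is jointly measurable and serves all base points `a` simultaneously.
  set F : ℝ × ℝ → ℂ := fun x => ∫ y in Set.Iic x.2, d (x.1, y) with hF
  have hFm : Measurable F := by
    have : StronglyMeasurable fun p : (ℝ × ℝ) × ℝ =>
        {p : (ℝ × ℝ) × ℝ | p.2 ≤ p.1.2}.indicator (fun p => d (p.1.1, p.2)) p :=
      (hm.comp_measurable (by fun_prop : Measurable fun p : (ℝ × ℝ) × ℝ => (p.1.1, p.2))).indicator
        (measurableSet_le (by fun_prop) (by fun_prop))
    have hFe : F = fun x => ∫ y, {p : (ℝ × ℝ) × ℝ | p.2 ≤ p.1.2}.indicator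
        (fun p => d (p.1.1, p.2)) (x, y) := by
      funext x
      simp only [hF]
      rw [← integral_indicator measurableSet_Iic]
      rfl
    rw [hFe]
    exact (this.integral_prod_right' (ν := volume)).measurable
  set qt : ℝ → ℝ × ℝ → ℂ := fun h x => h⁻¹ • (F (x.1, x.2 + h) - F x) - d x with hqt
  have hqm : ∀ h, Measurable (qt h) := by
    intro h
    have h1 : Measurable fun x : ℝ × ℝ => F (x.1, x.2 + h) := hFm.comp (by fun_prop)
    exact ((h1.sub hFm).const_smul h⁻¹).sub hm.measurable
  set S : Set (ℝ × ℝ) := {x | Tendsto (fun r : ℚ => qt r x)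
    (comap (fun r : ℚ => (r : ℝ)) (𝓝[≠] 0)) (𝓝 0)} with hS
  have hSm : MeasurableSet S := measurableSet_tendsto _ fun r => hqm r
  have hslice : ∀ᵐ z : ℝ, Integrable fun y => d (z, y) := hd.prod_right_ae
  have hFd : ∀ {z : ℝ}, (Integrable fun y => d (z, y)) → ∀ a t,
      ∫ y in a..t, d (z, y) = F (z, t) - F (z, a) := fun hz a t =>
    (intervalIntegral.integral_Iic_sub_Iic hz.integrableOn hz.integrableOn).symm
  have hiff : ∀ {z t : ℝ}, (Integrable fun y => d (z, y)) → ∀ a,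
      (HasDerivAt (fun t => ∫ y in a..t, d (z, y)) (d (z, t)) t
        ↔ Tendsto (fun h => qt h (z, t)) (𝓝[≠] 0) (𝓝 0)) := by
    intro z t hz a
    rw [hasDerivAt_iff_tendsto_slope_zero, ← tendsto_sub_nhds_zero_iff]
    simp only [hFd hz, sub_sub_sub_cancel_right, hqt]
  have hSae : ∀ᵐ x ∂((volume : Measure ℝ).prod (volume : Measure ℝ)), x ∈ S := by
    rw [Measure.ae_prod_mem_iff_ae_ae_mem hSm]
    filter_upwards [hslice] with z hz
    filter_upwards [LocallyIntegrable.ae_hasDerivAt_integral hz.locallyIntegrable] with t ht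
    exact ((hiff hz 0).1 (ht 0)).comp tendsto_comap
  have hslice' : ∀ᵐ x ∂((volume : Measure ℝ).prod (volume : Measure ℝ)),
      Integrable fun y => d (x.1, y) := Measure.quasiMeasurePreserving_fst.ae hslice
  filter_upwards [hSae, hslice'] with x hx hxi a
  refine (hiff hxi a).2 (tendsto_nhdsNE_of_tendsto_rat ?_ hx)
  have hFc : Continuous fun t => F (x.1, t) := by
    have h0 : Continuous fun t => ∫ y in (0 : ℝ)..t, d (x.1, y) :=
      intervalIntegral.continuous_primitive (fun _ _ => hxi.intervalIntegrable) 0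
    simp only [hFd hxi] at h0
    exact (h0.add (continuous_const (y := F (x.1, 0)))).congr fun t => sub_add_cancel _ _
  refine (ContinuousOn.smul (continuousOn_inv₀) ?_).sub continuousOn_const
  exact ((hFc.comp (continuous_const.add continuous_id)).sub continuous_const).continuousOn

/-- Replacing `d` by a measurable representative changes no primitive along almost every slice. -/
lemma ae_hasDerivAt_integral_snd {d : ℝ × ℝ → ℂ} (hd : Integrable d) :
    ∀ᵐ x : ℝ × ℝ, ∀ a : ℝ, HasDerivAt (fun t => ∫ y in a..t, d (x.1, y)) (d x) x.2 := by
  set d' := hd.aestronglyMeasurable.mk d with hd'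
  have heq : d =ᵐ[volume] d' := hd.aestronglyMeasurable.ae_eq_mk
  have h := ae_hasDerivAt_integral_snd_of_stronglyMeasurable (hd.congr heq)
    hd.aestronglyMeasurable.stronglyMeasurable_mk
  have heq' := heq
  rw [Measure.volume_eq_prod] at heq' h ⊢
  have hsl : ∀ᵐ x ∂((volume : Measure ℝ).prod (volume : Measure ℝ)),
      ∀ᵐ y, d (x.1, y) = d' (x.1, y) :=
    Measure.quasiMeasurePreserving_fst.ae (Measure.ae_ae_of_ae_prod heq')
  filter_upwards [h, heq', hsl] with x hx hxe hxs a
  rw [hxe]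
  refine (hx a).congr_of_eventuallyEq (Eventually.of_forall fun t => ?_)
  exact intervalIntegral.integral_congr_ae (hxs.mono fun y hy _ => hy)

/-! ### Derivatives of the double iterated integral -/

/-- The kernel `(t - y) ^ n / n!`, truncated to `a < y < t`. -/
def powKer (a : ℝ) (n : ℕ) (t y : ℝ) : ℂ :=
  (Set.Ioo a t).indicator (fun y => ((t - y : ℝ) : ℂ) ^ n / n.factorial) y

lemma measurable_powKer (a : ℝ) (n : ℕ) (t : ℝ) : Measurable (powKer a n t) :=
  Measurable.indicator (by fun_prop) measurableSet_Ioo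

lemma norm_powKer_le (a : ℝ) (n : ℕ) (t y : ℝ) : ‖powKer a n t y‖ ≤ |t - a| ^ n / n.factorial := by
  by_cases h : y ∈ Set.Ioo a t
  · rw [powKer, Set.indicator_of_mem h, norm_div, norm_pow, Complex.norm_natCast,
      Complex.norm_real, Real.norm_of_nonneg (sub_pos.2 h.2).le, abs_of_pos (by linarith [h.1, h.2])]
    have h1 : 0 ≤ t - y := (sub_pos.2 h.2).le
    have h2 : t - y ≤ t - a := by linarith [h.1]
    gcongr
  · rw [powKer, Set.indicator_of_notMem h, norm_zero]
    positivity

lemma integral_powKer_mul (a : ℝ) (n : ℕ) {t : ℝ} (ht : a ≤ t) {h : ℝ → ℂ} (hh : Integrable h) :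
    ∫ y, powKer a n t y * h y = iterInt a (n + 1) h t := by
  rw [← iterInt_eq_setIntegral hh a n ht, ← integral_indicator measurableSet_Ioo]
  congr 1
  funext y
  rw [powKer, Set.indicator_mul_left]

lemma integrable_integral_powKer_mul {d : ℝ × ℝ → ℂ} (hd : Integrable d) (a : ℝ) (n : ℕ) (t : ℝ) :
    Integrable fun ξ => ∫ y, powKer a n t y * d (ξ, y) := by
  rw [Measure.volume_eq_prod] at hd
  have : Integrable (fun p : ℝ × ℝ => powKer a n t p.2 * d p) (volume.prod volume) :=
    hd.bdd_mul ((measurable_powKer a n t).comp measurable_snd).aestronglyMeasurable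
      (Eventually.of_forall fun p => norm_powKer_le a n t _)
  exact this.integral_prod_left

lemma rlKer_natCast_add_one (n : ℕ) (u : ℝ) :
    rlKer ((n + 1 : ℕ) : ℂ) u = (u : ℂ) ^ n / n.factorial := by
  rw [rlKer]
  push_cast
  rw [add_sub_cancel_right, Complex.cpow_natCast, Complex.Gamma_nat_eq_factorial]

/-- At integer orders Fubini puts the `y`-integral inside as a pairing with the bounded weight
`powKer`, and Cauchy's formula treats the `z`-integral. -/
lemma volterra_rlKer₂_natCast {d : ℝ × ℝ → ℂ} {a b x : ℝ × ℝ} (hd : IntegrableOn d (rect a b))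
    (n r : ℕ) (hx : x ∈ rect a b) :
    volterra (rlKer₂ (n + 1 : ℕ) (r + 1 : ℕ)) d a x
      = iterInt a.1 (n + 1)
        (fun ξ => ∫ y, powKer a.2 r x.2 y * (rect a b).indicator d (ξ, y)) x.1 := by
  set dt := (rect a b).indicator d with hdt
  have hdi : Integrable dt := (integrable_indicator_iff (measurableSet_rect _ _)).2 hd
  rw [← iterInt_eq_setIntegral (integrable_integral_powKer_mul hdi a.2 r x.2) a.1 n hx.1.1.le]
  set k : ℝ × ℝ → ℂ := fun s =>
    ((x.1 - s.1 : ℝ) : ℂ) ^ n / n.factorial * (((x.2 - s.2 : ℝ) : ℂ) ^ r / r.factorial) with hk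
  have e : volterra (rlKer₂ (n + 1 : ℕ) (r + 1 : ℕ)) d a x = ∫ s in rect a x, k s * dt s := by
    refine setIntegral_congr_fun (measurableSet_rect a x) fun s hs => ?_
    have hs' : s ∈ rect a b := ⟨⟨hs.1.1, hs.1.2.trans hx.1.2⟩, hs.2.1, hs.2.2.trans hx.2.2⟩
    simp only [rlKer₂, rlKer_natCast_add_one, hdt, Set.indicator_of_mem hs', hk, Prod.fst_sub,
      Prod.snd_sub]
  have hint : IntegrableOn (fun s => k s * dt s) (rect a x) := by
    have hcomp : IsCompact (Set.Icc a x) := isCompact_Icc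
    refine (hdi.integrableOn.continuousOn_mul (Continuous.continuousOn ?_) hcomp).mono_set ?_
    · rw [hk]
      fun_prop
    · intro s hs
      exact ⟨⟨hs.1.1.le, hs.2.1.le⟩, hs.1.2.le, hs.2.2.le⟩
  rw [e, rect, Measure.volume_eq_prod, setIntegral_prod _ hint]
  refine setIntegral_congr_fun measurableSet_Ioo fun ξ _ => ?_
  simp only [hk, mul_assoc, integral_const_mul]
  congr 1
  rw [← integral_indicator measurableSet_Ioo]
  congr 1
  funext y
  rw [powKer, Set.indicator_mul_left]

lemma ae_iteratedDeriv_volterra {d : ℝ × ℝ → ℂ} {a b : ℝ × ℝ} (hd : IntegrableOn d (rect a b))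
    (n r : ℕ) {G : ℝ → ℝ → ℂ}
    (hG : ∀ x ∈ rect a b, G x.1 x.2 = volterra (rlKer₂ (n + 1 : ℕ) (r + 1 : ℕ)) d a x) :
    ∀ᵐ x ∂(volume.restrict (rect a b)),
      (∀ᶠ t in 𝓝 x.2, IterDifferentiableAt (n + 1) (fun z => G z t) x.1) ∧
      IterDifferentiableAt (r + 1) (fun t => iteratedDeriv (n + 1) (fun z => G z t) x.1) x.2 ∧
      iteratedDeriv (r + 1) (fun t => iteratedDeriv (n + 1) (fun z => G z t) x.1) x.2 = d x := by
  set dt := (rect a b).indicator d with hdt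
  have hdi : Integrable dt := (integrable_indicator_iff (measurableSet_rect _ _)).2 hd
  have hslice : ∀ᵐ z : ℝ, Integrable fun y => dt (z, y) := by
    rw [Measure.volume_eq_prod] at hdi
    exact hdi.prod_right_ae
  have h1 := ae_hasDerivAt_integral_slices hdi
  have h2 := ae_hasDerivAt_integral_snd hdi
  rw [ae_restrict_iff' (measurableSet_rect _ _)]
  rw [Measure.volume_eq_prod] at h2 ⊢
  filter_upwards [Measure.quasiMeasurePreserving_fst.ae hslice,
    Measure.quasiMeasurePreserving_fst.ae h1, h2] with x hxi hx1 hx2 hx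
  -- The condition imposed on `x.1` does not involve `t`, so at this one abscissa the
  -- `z`-derivatives exist for every `t`, and what remains is an iterated integral of the slice
  -- $d(x_1,\cdot)$.
  have key : ∀ t ∈ Set.Ioo a.2 b.2, IterDifferentiableAt (n + 1) (fun z => G z t) x.1 ∧
      iteratedDeriv (n + 1) (fun z => G z t) x.1 = iterInt a.2 (r + 1) (fun y => dt (x.1, y)) t := by
    intro t ht
    have heq : (fun z => G z t) =ᶠ[𝓝 x.1]
        iterInt a.1 (n + 1) (fun ξ => ∫ y, powKer a.2 r t y * dt (ξ, y)) := by
      filter_upwards [Ioo_mem_nhds hx.1.1 hx.1.2] with z hz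
      rw [← volterra_rlKer₂_natCast hd n r (x := (z, t)) ⟨hz, ht⟩]
      exact hG (z, t) ⟨hz, ht⟩
    have := iterDifferentiableAt_iterInt (integrable_integral_powKer_mul hdi a.2 r t)
      (hx1 (powKer a.2 r t) _ (measurable_powKer _ _ _) (norm_powKer_le _ _ _) a.1) n
    refine ⟨this.1.congr heq.symm, ?_⟩
    rw [heq.iteratedDeriv_eq, this.2, integral_powKer_mul _ _ ht.1.le hxi]
  have ht : ∀ᶠ t in 𝓝 x.2, t ∈ Set.Ioo a.2 b.2 := Ioo_mem_nhds hx.2.1 hx.2.2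
  have heq : (fun t => iteratedDeriv (n + 1) (fun z => G z t) x.1) =ᶠ[𝓝 x.2]
      iterInt a.2 (r + 1) (fun y => dt (x.1, y)) := ht.mono fun t ht => (key t ht).2
  have hfin := iterDifferentiableAt_iterInt hxi (hx2 a.2) r
  refine ⟨ht.mono fun t ht => (key t ht).1, hfin.1.congr heq.symm, ?_⟩
  rw [heq.iteratedDeriv_eq, hfin.2, hdt, Set.indicator_of_mem hx]

/-! ### The operators as Volterra operators -/

section Operators

variable {p q υ : ℂ}

lemma mlIntegrand_tiedParams (hυ : 0 < υ.re) (γ₁ γ₂ γ₃ p q w₁ w₂ : ℂ) (d : ℝ × ℝ → ℂ)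
    (a x : ℝ × ℝ) {s : ℝ × ℝ} (hs : s ∈ rect a x) :
    mlIntegrand (tiedParams γ₁ γ₂ γ₃) p q υ w₁ w₂ d x.1 x.2 s
      = mlKer (γ₁ / 2) γ₂ p q υ (-4 * w₁) (w₂ ^ υ) (x - s) * d s := by
  rw [mlIntegrand, ← cpow_mul_mlFun_tiedParams hυ γ₁ γ₂ γ₃ p q w₁ w₂ (u := x - s)
    (sub_pos.2 hs.1.2) (sub_pos.2 hs.2.2), Prod.fst_sub, Prod.snd_sub]

lemma mlOp_tiedParams (hυ : 0 < υ.re) (γ₁ γ₂ γ₃ p q w₁ w₂ : ℂ) (a : ℝ × ℝ) (d : ℝ × ℝ → ℂ) :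
    mlOp (tiedParams γ₁ γ₂ γ₃) p q υ w₁ w₂ a.1 a.2 d
      = volterra (mlKer (γ₁ / 2) γ₂ p q υ (-4 * w₁) (w₂ ^ υ)) d a :=
  funext fun x => setIntegral_congr_fun (measurableSet_rect a x) fun _ hs =>
    mlIntegrand_tiedParams hυ γ₁ γ₂ γ₃ p q w₁ w₂ d a x hs

lemma mlOpDefinedOn_tiedParams (hp : 0 < p.re) (hq : 0 < q.re) (hυ : 0 < υ.re)
    (γ₁ γ₂ γ₃ w₁ w₂ : ℂ) {a b : ℝ × ℝ} (h1 : a.1 < b.1) (h2 : a.2 < b.2) {d : ℝ × ℝ → ℂ}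
    (hd : IntegrableOn d (rect a b)) :
    MlOpDefinedOn (tiedParams γ₁ γ₂ γ₃) p q υ w₁ w₂ a.1 b.1 a.2 b.2 d := by
  have hK := integrableOn_mlKer hp hq hυ (γ₁ / 2) γ₂ (-4 * w₁) (w₂ ^ υ) (sub_pos.2 h1).le
    (sub_pos.2 h2).le
  obtain ⟨hae, hint⟩ := volterra_defined (a := a) (b := b) hK hd
  refine ⟨?_, ?_⟩
  · filter_upwards [hae] with x hx
    exact hx.congr_fun (fun s hs => (mlIntegrand_tiedParams hυ γ₁ γ₂ γ₃ p q w₁ w₂ d a x hs).symm)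
      (measurableSet_rect a x)
  · rw [mlOp_tiedParams hυ]
    exact hint

lemma rlIntegrand_eq {α β : ℂ} (hα : 0 < α.re) (hβ : 0 < β.re) (f : ℝ × ℝ → ℂ) (x s : ℝ × ℝ) :
    rlIntegrand α β f x.1 x.2 s
      = Complex.Gamma α * Complex.Gamma β * (rlKer₂ α β (x - s) * f s) := by
  have h1 := Gamma_ne_zero hα
  have h2 := Gamma_ne_zero hβ
  rw [rlIntegrand, rlKer₂, rlKer, rlKer, Prod.fst_sub, Prod.snd_sub]
  field_simp

lemma rlInt_eq_volterra {α β : ℂ} (hα : 0 < α.re) (hβ : 0 < β.re) (a x : ℝ × ℝ)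
    (f : ℝ × ℝ → ℂ) :
    rlInt α β a.1 a.2 f x.1 x.2 = volterra (rlKer₂ α β) f a x := by
  have h1 := Gamma_ne_zero hα
  have h2 := Gamma_ne_zero hβ
  rw [rlInt, volterra]
  simp only [rlIntegrand_eq hα hβ, integral_const_mul]
  field_simp

lemma integrableOn_rlKer₂ {α β : ℂ} (hα : 0 < α.re) (hβ : 0 < β.re) (c : ℝ × ℝ) :
    IntegrableOn (rlKer₂ α β) (rect 0 c) := by
  rw [IntegrableOn, rect, Measure.volume_eq_prod, ← Measure.prod_restrict]
  exact (integrableOn_rlKer hα c.1).mul_prod (integrableOn_rlKer hβ c.2)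

lemma rlOrder_sub_re_pos (α : ℂ) : 0 < ((rlOrder α : ℂ) - α).re := by
  have := Nat.lt_floor_add_one α.re
  simp only [rlOrder, Complex.sub_re, Complex.natCast_re]
  push_cast
  linarith

/-- The double Riemann–Liouville derivative is a left inverse of the double Riemann–Liouville
integral on `L¹`. -/
lemma rlDeriv_of_ae_eq_volterra {α β : ℂ} (hα : 0 < α.re) (hβ : 0 < β.re) {a b : ℝ × ℝ}
    {d f : ℝ × ℝ → ℂ} (hd : IntegrableOn d (rect a b))
    (hf : f =ᵐ[volume.restrict (rect a b)] volterra (rlKer₂ α β) d a) :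
    ∀ᵐ x ∂(volume.restrict (rect a b)),
      RlDerivExistsAt α β a.1 a.2 f x ∧ rlDeriv α β a.1 a.2 f x = d x := by
  have hα' := rlOrder_sub_re_pos α
  have hβ' := rlOrder_sub_re_pos β
  -- The composed order is the integer `rlOrder γ`, at least 1; this is the bound needed for
  -- composition at every point.
  have sum : ∀ γ : ℂ, 1 ≤ γ.re + ((rlOrder γ : ℂ) - γ).re := by
    intro γ
    simp only [rlOrder, Complex.sub_re, Complex.natCast_re, add_sub_cancel]
    push_cast
    linarith [Nat.cast_nonneg (α := ℝ) ⌊γ.re⌋₊]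
  obtain ⟨C, hC⟩ := integral_norm_rlKer₂_mul_rlKer₂_le hα hβ hα' hβ' (sum α) (sum β)
    (b - a).1 (b - a).2
  have hM : ∀ u ∈ rect 0 (b - a),
      ∫ s in rect 0 u, rlKer₂ α β s * rlKer₂ (rlOrder α - α) (rlOrder β - β) (u - s)
        = rlKer₂ (rlOrder α) (rlOrder β) u := by
    intro u hu
    have := integral_rlKer₂_mul_rlKer₂ hα hβ hα' hβ' hu.1.1 hu.2.1
    rwa [add_sub_cancel, add_sub_cancel] at this
  have hcomp := fun x (hx : x ∈ rect a b) => volterra_comp_of_bounded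
    (integrableOn_rlKer₂ hα hβ _) (integrableOn_rlKer₂ hα' hβ' _) hd hM hf hC hx
  have hG : ∀ x ∈ rect a b, rlInt (rlOrder α - α) (rlOrder β - β) a.1 a.2 f x.1 x.2
      = volterra (rlKer₂ (rlOrder α) (rlOrder β)) d a x := fun x hx => by
    rw [rlInt_eq_volterra hα' hβ', (hcomp x hx).2]
  filter_upwards [ae_iteratedDeriv_volterra hd ⌊α.re⌋₊ ⌊β.re⌋₊
    (G := rlInt (rlOrder α - α) (rlOrder β - β) a.1 a.2 f) hG,
    ae_restrict_mem (measurableSet_rect a b)] with x hx hxR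
  refine ⟨⟨?_, hx.1, hx.2.1⟩, hx.2.2⟩
  filter_upwards [(isOpen_rect a b).mem_nhds hxR] with u hu
  exact ((hcomp u hu).1.const_mul _).congr
    (Eventually.of_forall fun s => (rlIntegrand_eq hα' hβ' f u s).symm)

end Operators

end IKonhauser

end

/-! ### Inversion of the operator on $L^1(R)$ -/

theorem mainTheorem12
    (p q σ τ υ w₁ w₂ γ₁ γ₂ γ₃ : ℂ) (a₁ b₁ a₂ b₂ : ℝ)
    (hp : 0 < p.re) (hq : 0 < q.re) (hσ : 0 < σ.re) (hτ : 0 < τ.re) (hυ : 0 < υ.re)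
    (hγ₁ : 0 < γ₁.re) (hγ₂ : 0 < γ₂.re) (hγ₃ : 0 < γ₃.re)
    (hab₁ : a₁ < b₁) (hab₂ : a₂ < b₂) :
    -- both Mittag-Leffler series converge absolutely everywhere
    (∀ z t : ℂ, Summable fun i : ℕ × ℕ =>
      IKonhauser.mlTerm (IKonhauser.tiedParams γ₁ γ₂ γ₃) p q υ z t i.1 i.2) ∧
    (∀ z t : ℂ, Summable fun i : ℕ × ℕ =>
      IKonhauser.mlTerm (IKonhauser.tiedParams (-γ₁) (-γ₂) (-γ₃)) σ τ υ z t i.1 i.2) ∧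
    -- `𝔻 ∘ 𝔈 = id` on `L¹`, all operations being defined
    ∀ d : ℝ × ℝ → ℂ, IntegrableOn d (Set.Ioo a₁ b₁ ×ˢ Set.Ioo a₂ b₂) →
      IKonhauser.MlOpDefinedOn (IKonhauser.tiedParams γ₁ γ₂ γ₃) p q υ w₁ w₂ a₁ b₁ a₂ b₂ d ∧
      ∀ φ : ℝ × ℝ → ℂ,
        φ =ᵐ[volume.restrict (Set.Ioo a₁ b₁ ×ˢ Set.Ioo a₂ b₂)]
          IKonhauser.mlOp (IKonhauser.tiedParams γ₁ γ₂ γ₃) p q υ w₁ w₂ a₁ a₂ d →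
        IKonhauser.MlOpDefinedOn (IKonhauser.tiedParams (-γ₁) (-γ₂) (-γ₃)) σ τ υ w₁ w₂
          a₁ b₁ a₂ b₂ φ ∧
        ∀ᵐ x ∂(volume.restrict (Set.Ioo a₁ b₁ ×ˢ Set.Ioo a₂ b₂)),
          IKonhauser.RlDerivExistsAt (p + σ) (q + τ) a₁ a₂
            (IKonhauser.mlOp (IKonhauser.tiedParams (-γ₁) (-γ₂) (-γ₃)) σ τ υ w₁ w₂ a₁ a₂ φ) x ∧
          IKonhauser.leftInvOp γ₁ γ₂ γ₃ p q σ τ υ w₁ w₂ a₁ a₂ φ x = d x := by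
  have hpσ : 0 < (p + σ).re := by simpa using add_pos hp hσ
  have hqτ : 0 < (q + τ).re := by simpa using add_pos hq hτ
  refine ⟨IKonhauser.summable_mlTerm_tiedParams hυ γ₁ γ₂ γ₃ p q,
    IKonhauser.summable_mlTerm_tiedParams hυ (-γ₁) (-γ₂) (-γ₃) σ τ, fun d hd => ?_⟩
  have hdef := IKonhauser.mlOpDefinedOn_tiedParams hp hq hυ γ₁ γ₂ γ₃ w₁ w₂
    (a := (a₁, a₂)) (b := (b₁, b₂)) hab₁ hab₂ hd
  refine ⟨hdef, fun φ hφ => ?_⟩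
  have hφi : IntegrableOn φ (IKonhauser.rect (a₁, a₂) (b₁, b₂)) := hdef.2.congr_fun_ae hφ.symm
  refine ⟨IKonhauser.mlOpDefinedOn_tiedParams hσ hτ hυ (-γ₁) (-γ₂) (-γ₃) w₁ w₂
    (a := (a₁, a₂)) (b := (b₁, b₂)) hab₁ hab₂ hφi, ?_⟩
  have hK := fun (a b : ℂ) {p q : ℂ} (hp : 0 < p.re) (hq : 0 < q.re) =>
    IKonhauser.integrableOn_mlKer hp hq hυ a b (-4 * w₁) (w₂ ^ υ)
      (sub_pos.2 hab₁).le (sub_pos.2 hab₂).le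
  rw [IKonhauser.mlOp_tiedParams hυ γ₁ γ₂ γ₃ p q w₁ w₂ (a₁, a₂)] at hφ
  refine IKonhauser.rlDeriv_of_ae_eq_volterra (a := (a₁, a₂)) (b := (b₁, b₂)) hpσ hqτ hd ?_
  -- `neg_div` exhibits the second kernel as the one with parameters $-a$, $-b$ for $a=\gamma_1/2$,
  -- $b=\gamma_2$.
  rw [IKonhauser.mlOp_tiedParams hυ (-γ₁) (-γ₂) (-γ₃) σ τ w₁ w₂ (a₁, a₂), neg_div]
  exact IKonhauser.volterra_comp_ae (a := (a₁, a₂)) (b := (b₁, b₂)) (hK _ _ hp hq) (hK _ _ hσ hτ)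
    hd (fun u hu => IKonhauser.integral_mlKer_mul_mlKer_neg hp hq hσ hτ hυ _ _ _ _
      hu.1.1 hu.2.1) hφ
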